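/- Let $N_a\ge 1$ agents form opinions about $N_o\ge 2$ options. Agent $i$ has state $Z_i=(z_{i1},\dots,z_{iN_o})\in\mathbf 1^\perp=\{x\in\mathbb R^{N_o}:\sum_j x_j=0\}$, and the system state is $Z=(Z_1,\dots,Z_{N_a})\in V=(\mathbf 1^\perp)^{N_a}\cong\mathbb R^{N_a}\otimes\mathbf 1^\perp$. Let $P_0=I-\frac1{N_o}\mathbf 1\mathbf 1^T$ and consider on $V$ the dynamics with zero input $\dot Z_i=P_0F_i(Z)$, $$F_{ij}(Z)=-d\,z_{ij}+u\Big(S_1\big(\alpha z_{ij}+\sum_{k\ne i}\gamma_{ik}z_{kj}\big)+\sum_{l\neq j}S_2\big(\beta z_{il}+\sum_{k\neq i}\delta_{ik}z_{kl}\big)\Big),$$ where $d>0$, $u>0$, $\alpha,\beta\in\mathbb R$, the matrices $\Gamma=(\gamma_{ik})$, $\Delta=(\delta_{ik})\in\mathbb R^{N_a\times N_a}$ have zero diagonal, and each $S_q:\mathbb R\to[-k_{q1},k_{q2}]$ (with $k_{q1},k_{q2}>0$) is of class $C^3$ with $S_q(0)=0$, $S_q'(0)=1$, $S_q''(0)\ne0$,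 $S_q'''(0)\neq0$. Let $\lambda$ be the eigenvalue of $\Gamma-\Delta$ with largest real part; assume that $\lambda$ is real, that no other eigenvalue of $\Gamma-\Delta$ has real part $\lambda$, and that $\alpha-\beta+\lambda>0$. Put $u^*=d/(\alpha-\beta+\lambda)$. (1) The neutral state $Z=0$ is locally exponentially stable for $0<u<u^*$ and unstable for $u>u^*$. (2) Suppose in addition that $\lambda$ is simple, and let $\mathbf v^*$ be a unit eigenvector of $\Gamma-\Delta$ for $\lambda$. Let $J$ be the Jacobian of the dynamics at $Z=0$ for $u=u^*$. Call a bifurcation branch a continuous curve $s\mapsto(Z(s),u(s))$, $0\le s<\varepsilon$, of equilibria with $(Z(0),u(0))=(0,u^*)$ and $Z(s)\neq0$ for $s>0$. Call $\mathbf v_{ax}\in\mathbf 1^\perp$ axial if it spans the fixed-point subspace of an axial subgroup, i.e. of an isotropy subgroup, with one-dimensional fixed-point subspace, of the permutation action of $\mathfrak S_{N_o}$ on $\mathbf 1^\perp$. Then $\ker J=\mathbb R\{\mathbf v^*\}\otimes\mathbf 1^\perp$, and a steady-state bifurcation occurs at $u=u^*$ along $\ker J$: bifurcation branches exist, every bifurcation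 branch is tangent at $Z=0$ to $\ker J$, and for every axial $\mathbf v_{ax}$ there is a bifurcation branch with $Z'(0)=\mathbf v^*\otimes\mathbf v_{ax}$. (3) Generically, every bifurcation branch is tangent at $Z=0$ to $\mathbb R\{\mathbf v^*\otimes\mathbf v_{ax}\}$ for some axial $\mathbf v_{ax}$. Precisely: for every fixed $N_a,N_o,d,S_1,S_2$ as above, this holds for all $(\alpha,\beta,\Gamma,\Delta)$ in a relatively open and dense subset of the set of parameters that satisfy the assumptions above with $\lambda$ simple. -/

import Mathlib

open Set Filter Topology Asymptotics

/-! ### State space and model -/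

/-- The opinion space `𝟏ᗮ ⊆ ℝ^{No}` of a single agent: vectors whose entries sum to zero. -/
def optionSpace (No : ℕ) : Submodule ℝ (Fin No → ℝ) where
  carrier := {x | ∑ j, x j = 0}
  add_mem' := by
    intro x y hx hy
    change ∑ j, x j = 0 at hx
    change ∑ j, y j = 0 at hy
    change ∑ j, (x j + y j) = 0
    rw [Finset.sum_add_distrib, hx, hy, add_zero]
  zero_mem' := by
    change ∑ _j : Fin No, (0 : ℝ) = 0
    simp
  smul_mem' := by
    intro c x hx
    change ∑ j, x j = 0 at hx
    change ∑ j, c * x j = 0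
    rw [← Finset.mul_sum, hx, mul_zero]

/-- The state space `V = 𝟏ᗮ × ⋯ × 𝟏ᗮ` (`Na` factors). It is finite dimensional and every topological
or asymptotic notion used below is independent of the choice of the norm on it. -/
abbrev StateSpace (Na No : ℕ) : Type := Fin Na → optionSpace No

/-- The projection `P₀ = I - (1/No) 𝟏 𝟏ᵀ` of `ℝ^{No}` onto `𝟏ᗮ`. -/
noncomputable def optionProj {No : ℕ} (y : Fin No → ℝ) : optionSpace No :=
  ⟨fun j => y j - (1 / (No : ℝ)) * ∑ l, y l, by
    change ∑ j, (y j - (1 / (No : ℝ)) * ∑ l, y l) = 0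
    rcases Nat.eq_zero_or_pos No with h | h
    · subst h
      simp
    · have h' : (No : ℝ) ≠ 0 := by exact_mod_cast h.ne'
      rw [Finset.sum_sub_distrib]
      simp only [Finset.sum_const, Finset.card_univ, Fintype.card_fin, nsmul_eq_mul]
      field_simp
      ring⟩

/-- A saturating function: bounded, with `S(0) = 0`, `S'(0) = 1`, `S''(0) ≠ 0`, `S'''(0) ≠ 0`, and
just smooth enough for these conditions. Monotonicity is not required. -/
structure IsSaturating (S : ℝ → ℝ) : Prop where
  contDiff : ContDiff ℝ 3 S
  bounded : ∃ k₁ k₂ : ℝ, 0 < k₁ ∧ 0 < k₂ ∧ ∀ y, S y ∈ Icc (-k₁) k₂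
  map_zero : S 0 = 0
  deriv_zero : deriv S 0 = 1
  deriv_two_ne : iteratedDeriv 2 S 0 ≠ 0
  deriv_three_ne : iteratedDeriv 3 S 0 ≠ 0

/-- The general opinion drift `F_{ij}(Z)`, with heterogeneous agent parameters, coupling matrices
`Γ = (γ_{ik})`, `Δ = (δ_{ik})` (only entries with `k ≠ i` are used) and inputs `b`. -/
noncomputable def opinionDrift {Na No : ℕ} (S₁ S₂ : ℝ → ℝ) (d u α β : Fin Na → ℝ)
    (Γ Δ : Matrix (Fin Na) (Fin Na) ℝ) (b : Fin Na → Fin No → ℝ)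
    (Z : StateSpace Na No) (i : Fin Na) (j : Fin No) : ℝ :=
  -d i * (Z i).1 j + b i j +
    u i * (S₁ (α i * (Z i).1 j + ∑ k ∈ Finset.univ.erase i, Γ i k * (Z k).1 j) +
      ∑ l ∈ Finset.univ.erase j,
        S₂ (β i * (Z i).1 l + ∑ k ∈ Finset.univ.erase i, Δ i k * (Z k).1 l))

/-- The opinion dynamics `Ż_i = P₀ F_i(Z)` on `V`. -/
noncomputable def opinionField {Na No : ℕ} (S₁ S₂ : ℝ → ℝ) (d u α β : Fin Na → ℝ)
    (Γ Δ : Matrix (Fin Na) (Fin Na) ℝ) (b : Fin Na → Fin No → ℝ)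
    (Z : StateSpace Na No) : StateSpace Na No :=
  fun i => optionProj (opinionDrift S₁ S₂ d u α β Γ Δ b Z i)

/-- The dynamics with zero input and homogeneous `d, α, β`, as a family of vector fields indexed by
the homogeneous attention parameter `u`. -/
noncomputable def homField {Na : ℕ} (No : ℕ) (S₁ S₂ : ℝ → ℝ) (d α β : ℝ)
    (Γ Δ : Matrix (Fin Na) (Fin Na) ℝ) (u : ℝ) : StateSpace Na No → StateSpace Na No :=
  opinionField S₁ S₂ (fun _ => d) (fun _ => u) (fun _ => α) (fun _ => β) Γ Δ 0

/-! ### Stability of the origin for an autonomous vector field -/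

section Dynamics

variable {E : Type*} [NormedAddCommGroup E] [NormedSpace ℝ E]

/-- `Z` solves `Ż = f(Z)` on the time interval `[0, T]`. -/
def IsSolutionOn (f : E → E) (T : ℝ) (Z : ℝ → E) : Prop :=
  ∀ t ∈ Icc 0 T, HasDerivWithinAt Z (f (Z t)) (Icc 0 T) t

/-- Local exponential stability of the origin. -/
def IsLocallyExpStable (f : E → E) : Prop :=
  ∃ r > 0, ∃ C > 0, ∃ κ > 0, ∀ (T : ℝ) (Z : ℝ → E), IsSolutionOn f T Z → ‖Z 0‖ < r →
    ∀ t ∈ Icc 0 T, ‖Z t‖ ≤ C * Real.exp (-κ * t) * ‖Z 0‖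

/-- Lyapunov stability of the origin; the origin is unstable if this fails. -/
def IsLyapunovStable (f : E → E) : Prop :=
  ∀ ε > 0, ∃ r > 0, ∀ (T : ℝ) (Z : ℝ → E), IsSolutionOn f T Z → ‖Z 0‖ < r →
    ∀ t ∈ Icc 0 T, ‖Z t‖ < ε

/-- A bifurcation branch of the family `Ż = f u Z` at `(Z, u) = (0, u₀)`: a continuous curve
`s ↦ (Z s, u s)` of equilibria, `0 ≤ s < ε`, that starts at `(0, u₀)` and has `Z s ≠ 0` for
`s > 0`. -/
def IsBifurcationBranch (f : ℝ → E → E) (u₀ : ℝ) (u : ℝ → ℝ) (Z : ℝ → E) : Prop :=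
  Z 0 = 0 ∧ u 0 = u₀ ∧ ∃ ε > 0, ContinuousOn Z (Ico 0 ε) ∧ ContinuousOn u (Ico 0 ε) ∧
    ∀ s ∈ Ioo 0 ε, Z s ≠ 0 ∧ f (u s) (Z s) = 0

/-- The curve `Z`, starting at the origin, is tangent there to the subspace `K`:
`Z(s) = p(s) + o(‖Z(s)‖)` with `p(s) ∈ K`, as `s ↓ 0`. -/
def IsTangentTo (Z : ℝ → E) (K : Submodule ℝ E) : Prop :=
  ∃ p : ℝ → E, (∀ s, p s ∈ K) ∧ (fun s => Z s - p s) =o[𝓝[>] 0] Z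

end Dynamics

/-! ### Axial vectors of the permutation action on `𝟏ᗮ` -/

/-- The isotropy subgroup of `x ∈ 𝟏ᗮ` under permutations of the options. -/
def optionIsotropy {No : ℕ} (x : optionSpace No) : Subgroup (Equiv.Perm (Fin No)) where
  carrier := {σ | ∀ j, x.1 (σ j) = x.1 j}
  mul_mem' := by
    intro σ τ hσ hτ j
    rw [Equiv.Perm.mul_apply, hσ, hτ]
  one_mem' := by
    intro j
    simp
  inv_mem' := by
    intro σ hσ j
    have := hσ (σ⁻¹ j)
    simpa using this.symm

/-- The fixed-point subspace in `𝟏ᗮ` of a group of permutations of the options. -/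
def optionFixed {No : ℕ} (H : Subgroup (Equiv.Perm (Fin No))) :
    Submodule ℝ (optionSpace No) where
  carrier := {x | ∀ σ ∈ H, ∀ j, x.1 (σ j) = x.1 j}
  add_mem' := by
    intro x y hx hy σ hσ j
    simp [hx σ hσ j, hy σ hσ j]
  zero_mem' := by
    intro σ _ j
    simp
  smul_mem' := by
    intro c x hx σ hσ j
    simp [hx σ hσ j]

/-- An axial subgroup: an isotropy subgroup with one-dimensional fixed-point subspace. -/
def IsAxialSubgroup {No : ℕ} (H : Subgroup (Equiv.Perm (Fin No))) : Prop :=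
  (∃ x : optionSpace No, optionIsotropy x = H) ∧ Module.finrank ℝ (optionFixed H) = 1

/-- An axial vector: a generator of the fixed-point subspace of an axial subgroup. -/
def IsAxialVector {No : ℕ} (x : optionSpace No) : Prop :=
  ∃ H : Subgroup (Equiv.Perm (Fin No)), IsAxialSubgroup H ∧ optionFixed H = Submodule.span ℝ {x}

/-- The linear map `x ↦ v ⊗ x` from `𝟏ᗮ` to `V`; its range is `ℝ{v} ⊗ 𝟏ᗮ`. -/
def tensorState {Na : ℕ} (No : ℕ) (v : Fin Na → ℝ) : optionSpace No →ₗ[ℝ] StateSpace Na No where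
  toFun x := fun i => v i • x
  map_add' := by
    intro x y
    funext i
    simp
  map_smul' := by
    intro c x
    funext i
    simp [smul_comm c (v i) x]

/-! ### Spectral hypotheses -/

/-- The real number `lam` is the eigenvalue of `M` with largest real part among all complex
eigenvalues, and no other eigenvalue has the same real part. -/
structure IsLeadingEigenvalue {n : ℕ} (M : Matrix (Fin n) (Fin n) ℝ) (lam : ℝ) : Prop where
  mem : (lam : ℂ) ∈ spectrum ℂ (M.map Complex.ofReal)
  re_le : ∀ μ ∈ spectrum ℂ (M.map Complex.ofReal), μ.re ≤ lam
  re_ne : ∀ μ ∈ spectrum ℂ (M.map Complex.ofReal), μ ≠ (lam : ℂ) → μ.re ≠ lam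

/-- `lam` is a simple eigenvalue of `M` (algebraic multiplicity one). -/
def IsSimpleEigenvalue {n : ℕ} (M : Matrix (Fin n) (Fin n) ℝ) (lam : ℝ) : Prop :=
  M.charpoly.rootMultiplicity lam = 1

/-- Standing hypotheses on `(α, β, Γ, Δ)` and `lam`. The couplings `γ_{ik}`, `δ_{ik}` are between
distinct agents, i.e. `Γ` and `Δ` have zero diagonal. -/
structure IsAdmissible {Na : ℕ} (α β : ℝ) (Γ Δ : Matrix (Fin Na) (Fin Na) ℝ) (lam : ℝ) :
    Prop where
  diag_left : ∀ i, Γ i i = 0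
  diag_right : ∀ i, Δ i i = 0
  leading : IsLeadingEigenvalue (Γ - Δ) lam
  pos : 0 < α - β + lam

/-- The set of parameters `(α, β, Γ, Δ)` that satisfy the standing hypotheses with a simple leading
eigenvalue. -/
def simpleParams (Na : ℕ) :
    Set (ℝ × ℝ × Matrix (Fin Na) (Fin Na) ℝ × Matrix (Fin Na) (Fin Na) ℝ) :=
  {p | ∃ lam, IsAdmissible p.1 p.2.1 p.2.2.1 p.2.2.2 lam ∧
    IsSimpleEigenvalue (p.2.2.1 - p.2.2.2) lam}

/-! The projection kills vectors that are constant over the options, so the sum over the other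
options may be replaced by minus the own term: with `A = α + Γ`, `B = β + Δ` the field is `-d Z + u
(P₀ S₁(A Z) - P₀ S₂(B Z))` (`homField_eq`). Its linearization at 0 is `(u (α - β) - d) + u (Γ - Δ)`,
acting on agents only. Its leading eigenvalue `u (α - β + λ) - d` changes sign at `u*`.

Stability: by Gelfand's formula there is an equivalent seminorm in which the linear field grows at
most at a prescribed rate above the spectral abscissa (`exists_adapted`). Below `u*` the rate is
taken negative and the quadratic remainder is absorbed. Above `u*` the solution starting on the
leading eigenvector is compared with the exact mode `η e^{μt}`: its deviation is quadratic in the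
mode because the rate can be taken below `2μ`, so small data reach a fixed size.

Axial branches: functions of the coordinates of an axial `x` project to multiples of `x`, so the
states `y ⊗ x` form an invariant subspace. There the equilibrium equation, divided by the amplitude,
is regular at amplitude zero because `S(t) = t q(t)`. Since `λ` is simple, the left eigenvector `l`
can be normalized by `l · v = 1`, and the implicit function theorem gives the branch
(`exists_axial_branch`).

Generic tangency: contracting the equation along a branch with `l` gives, for `κ = α - β + λ` and `ξ
= l · Z`, `(u κ - d) ξ + u c₂ P₀(ξ²) = o(‖Z‖²)` (`branch_reduced_isLittleO`). If `c₂ ≠ 0`, the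
direction of `ξ` can accumulate only at unit vectors `x` with `P₀(x²)` parallel to `x`. The entries
of such a vector satisfy one quadratic equation, which makes it axial, and there are finitely many
(`finite_projSqCross_eq_zero`). A continuous curve with finitely many possible limits converges.
Finally `c₂ = 0` is relatively closed among simple parameters, and it is destroyed by shifting `A`
and `B` together, which changes neither `Γ - Δ` nor `α - β` (`simpleParams_subset_closure`). -/

/-! ### The vector field in matrix form -/

/-- The projection `optionProj` as a continuous linear map. -/
noncomputable def optionProjL (No : ℕ) : (Fin No → ℝ) →L[ℝ] optionSpace No :=
  LinearMap.toContinuousLinearMap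
    { toFun := optionProj
      map_add' := by
        intro x y
        ext j
        simp only [optionProj, Submodule.coe_add, Pi.add_apply, Finset.sum_add_distrib]
        ring
      map_smul' := by
        intro c x
        ext j
        simp only [optionProj, Submodule.coe_smul, Pi.smul_apply, smul_eq_mul, ← Finset.mul_sum,
          RingHom.id_apply]
        ring }

theorem optionProjL_apply {No : ℕ} (y : Fin No → ℝ) : optionProjL No y = optionProj y := rfl

theorem optionProjL_coe {No : ℕ} (y : Fin No → ℝ) (j : Fin No) :
    (optionProjL No y).1 j = y j - (1 / (No : ℝ)) * ∑ l, y l := rfl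

theorem optionSpace_sum {No : ℕ} (x : optionSpace No) : ∑ j, x.1 j = 0 := x.2

theorem optionProjL_of_mem {No : ℕ} (x : optionSpace No) : optionProjL No x.1 = x := by
  ext j
  rw [optionProjL_coe, optionSpace_sum, mul_zero, sub_zero]

theorem optionProjL_const {No : ℕ} (c : ℝ) : optionProjL No (fun _ => c) = 0 := by
  ext j
  have h : (No : ℝ) ≠ 0 := by
    have := j.pos
    positivity
  rw [optionProjL_coe]
  simp [h]

/-- A matrix acting on the agents: `A ⊗ I` on `ℝ^{Na} ⊗ 𝟏ᗮ`. -/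
noncomputable def agentAct {Na : ℕ} (No : ℕ) (A : Matrix (Fin Na) (Fin Na) ℝ) :
    StateSpace Na No →L[ℝ] StateSpace Na No :=
  LinearMap.toContinuousLinearMap
    { toFun := fun Z i => ∑ k, A i k • Z k
      map_add' := by
        intro x y
        funext i
        simp [Finset.sum_add_distrib]
      map_smul' := by
        intro c x
        funext i
        simp [Finset.smul_sum, smul_comm c] }

theorem agentAct_apply {Na No : ℕ} (A : Matrix (Fin Na) (Fin Na) ℝ) (Z : StateSpace Na No)
    (i : Fin Na) : agentAct No A Z i = ∑ k, A i k • Z k := rfl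

theorem agentAct_coe {Na No : ℕ} (A : Matrix (Fin Na) (Fin Na) ℝ) (Z : StateSpace Na No)
    (i : Fin Na) (j : Fin No) : (agentAct No A Z i).1 j = ∑ k, A i k * (Z k).1 j := by
  rw [agentAct_apply]
  simp

theorem agentAct_add {Na No : ℕ} (A B : Matrix (Fin Na) (Fin Na) ℝ) (Z : StateSpace Na No) :
    agentAct No (A + B) Z = agentAct No A Z + agentAct No B Z := by
  funext i
  simp [agentAct_apply, add_smul, Finset.sum_add_distrib]

theorem agentAct_sub {Na No : ℕ} (A B : Matrix (Fin Na) (Fin Na) ℝ) (Z : StateSpace Na No) :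
    agentAct No (A - B) Z = agentAct No A Z - agentAct No B Z := by
  rw [eq_sub_iff_add_eq, ← agentAct_add, sub_add_cancel]

theorem agentAct_smul {Na No : ℕ} (c : ℝ) (A : Matrix (Fin Na) (Fin Na) ℝ)
    (Z : StateSpace Na No) : agentAct No (c • A) Z = c • agentAct No A Z := by
  funext i
  simp [agentAct_apply, mul_smul, Finset.smul_sum]

theorem agentAct_one {Na No : ℕ} (Z : StateSpace Na No) :
    agentAct No (1 : Matrix (Fin Na) (Fin Na) ℝ) Z = Z := by
  funext i
  simp [agentAct_apply, Matrix.one_apply]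

theorem agentAct_mul {Na No : ℕ} (A B : Matrix (Fin Na) (Fin Na) ℝ) (Z : StateSpace Na No) :
    agentAct No (A * B) Z = agentAct No A (agentAct No B Z) := by
  funext i
  simp only [agentAct_apply, Matrix.mul_apply, Finset.sum_smul, Finset.smul_sum, mul_smul]
  exact Finset.sum_comm

theorem tensorState_apply {Na No : ℕ} (v : Fin Na → ℝ) (x : optionSpace No) (i : Fin Na) :
    tensorState No v x i = v i • x := rfl

theorem agentAct_tensorState {Na No : ℕ} (A : Matrix (Fin Na) (Fin Na) ℝ) (v : Fin Na → ℝ)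
    (x : optionSpace No) : agentAct No A (tensorState No v x) = tensorState No (A.mulVec v) x := by
  funext i
  simp only [agentAct_apply, tensorState_apply, Matrix.mulVec, dotProduct, Finset.sum_smul,
    mul_smul]

/-- The projected nonlinear response `Z ↦ P₀ S(A Z)`. -/
noncomputable def response {Na No : ℕ} (S : ℝ → ℝ) (A : Matrix (Fin Na) (Fin Na) ℝ)
    (Z : StateSpace Na No) : StateSpace Na No :=
  fun i => optionProjL No fun j => S ((agentAct No A Z i).1 j)

/-- The difference of the responses inside and across options. -/
noncomputable def netResponse {Na No : ℕ} (S₁ S₂ : ℝ → ℝ) (A B : Matrix (Fin Na) (Fin Na) ℝ)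
    (Z : StateSpace Na No) : StateSpace Na No :=
  response S₁ A Z - response S₂ B Z

theorem agentAct_smul_one_add_coe {Na No : ℕ} (c : ℝ) (A : Matrix (Fin Na) (Fin Na) ℝ)
    (hA : ∀ i, A i i = 0) (Z : StateSpace Na No) (i : Fin Na) (j : Fin No) :
    (agentAct No (c • 1 + A) Z i).1 j =
      c * (Z i).1 j + ∑ k ∈ Finset.univ.erase i, A i k * (Z k).1 j := by
  rw [agentAct_add, agentAct_smul, agentAct_one, Finset.sum_erase_eq_sub (Finset.mem_univ i), hA]
  simp [agentAct_coe]

/-- The sum over `l ≠ j` is the full sum minus the term at `j`. The full sum does not depend on `j`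
and is removed by the projection, so cross-option coupling enters with a minus sign. -/
theorem homField_eq {Na No : ℕ} (S₁ S₂ : ℝ → ℝ) (d α β : ℝ) {Γ Δ : Matrix (Fin Na) (Fin Na) ℝ}
    (hΓ : ∀ i, Γ i i = 0) (hΔ : ∀ i, Δ i i = 0) (u : ℝ) (Z : StateSpace Na No) :
    homField No S₁ S₂ d α β Γ Δ u Z =
      -(d • Z) + u • netResponse S₁ S₂ (α • 1 + Γ) (β • 1 + Δ) Z := by
  funext i
  have key : (opinionDrift S₁ S₂ (fun _ => d) (fun _ => u) (fun _ => α) (fun _ => β) Γ Δ 0 Z i :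
      Fin No → ℝ) = -(d • (Z i).1) + u • ((fun j => S₁ ((agentAct No (α • 1 + Γ) Z i).1 j)) -
        fun j => S₂ ((agentAct No (β • 1 + Δ) Z i).1 j)) +
        fun _ => u * ∑ l, S₂ ((agentAct No (β • 1 + Δ) Z i).1 l) := by
    funext j
    simp only [opinionDrift, Pi.add_apply, Pi.neg_apply, Pi.smul_apply, Pi.sub_apply,
      Pi.zero_apply, smul_eq_mul, agentAct_smul_one_add_coe α Γ hΓ,
      agentAct_smul_one_add_coe β Δ hΔ]
    rw [Finset.sum_erase_eq_sub (Finset.mem_univ j)]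
    ring
  change optionProj _ = _
  rw [← optionProjL_apply, key]
  simp only [map_add, map_neg, map_smul, map_sub, optionProjL_const, optionProjL_of_mem, add_zero]
  rfl

/-! ### Taylor expansion at the neutral state -/

theorem IsSaturating.isLittleO_two {S : ℝ → ℝ} (hS : IsSaturating S) :
    (fun t => S t - t - iteratedDeriv 2 S 0 / 2 * t ^ 2) =o[𝓝 0] fun t => t ^ 2 := by
  have h := taylor_isLittleO_univ (x₀ := 0) (n := 2) (hS.contDiff.of_le (by norm_num))
  refine (h.congr_left fun t => ?_).congr_right fun t => by rw [sub_zero]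
  simp only [taylorWithinEval_succ, taylor_within_zero_eval, iteratedDerivWithin_univ,
    zero_add, iteratedDeriv_one, hS.map_zero, hS.deriv_zero]
  norm_num [Nat.factorial]
  ring

theorem IsSaturating.continuous {S : ℝ → ℝ} (hS : IsSaturating S) : Continuous S :=
  hS.contDiff.continuous

/-- The componentwise square, projected to the opinion space. -/
noncomputable def projSq {No : ℕ} (x : optionSpace No) : optionSpace No :=
  optionProjL No fun j => x.1 j ^ 2

/-- The quadratic part of the response. -/
noncomputable def quadResponse {Na No : ℕ} (A : Matrix (Fin Na) (Fin Na) ℝ)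
    (Z : StateSpace Na No) : StateSpace Na No :=
  fun i => projSq (agentAct No A Z i)

/-- The coordinate `Z ↦ z_{ij}`. -/
noncomputable def stateCoord {Na No : ℕ} (i : Fin Na) (j : Fin No) :
    StateSpace Na No →L[ℝ] ℝ :=
  (ContinuousLinearMap.proj (R := ℝ) (φ := fun _ : Fin No => ℝ) j).comp
    ((optionSpace No).subtypeL.comp (ContinuousLinearMap.proj (R := ℝ)
      (φ := fun _ : Fin Na => optionSpace No) i))

theorem abs_coe_le_norm {No : ℕ} (x : optionSpace No) (j : Fin No) : |x.1 j| ≤ ‖x‖ :=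
  norm_le_pi_norm x.1 j

theorem abs_agentAct_coe_le {Na No : ℕ} (A : Matrix (Fin Na) (Fin Na) ℝ) (Z : StateSpace Na No)
    (i : Fin Na) (j : Fin No) : |(agentAct No A Z i).1 j| ≤ ‖agentAct No A‖ * ‖Z‖ :=
  (abs_coe_le_norm _ j).trans ((norm_le_pi_norm _ i).trans ((agentAct No A).le_opNorm Z))

theorem response_isLittleO {Na No : ℕ} {S : ℝ → ℝ} (hS : IsSaturating S)
    (A : Matrix (Fin Na) (Fin Na) ℝ) :
    (fun Z : StateSpace Na No => response S A Z - agentAct No A Z -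
      (iteratedDeriv 2 S 0 / 2) • quadResponse A Z) =o[𝓝 0] fun Z => ‖Z‖ ^ 2 := by
  set a := iteratedDeriv 2 S 0 / 2 with ha
  rw [isLittleO_pi]
  intro i
  have h1 : (fun (Z : StateSpace Na No) (j : Fin No) => S ((agentAct No A Z i).1 j) -
      (agentAct No A Z i).1 j - a * (agentAct No A Z i).1 j ^ 2) =o[𝓝 0] fun Z => ‖Z‖ ^ 2 := by
    rw [isLittleO_pi]
    intro j
    have hc : Tendsto (fun Z : StateSpace Na No => (agentAct No A Z i).1 j) (𝓝 0) (𝓝 0) := by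
      have := ((stateCoord i j).comp (agentAct No A)).continuous.tendsto 0
      rwa [map_zero] at this
    refine (hS.isLittleO_two.comp_tendsto hc).trans_isBigO ?_
    refine IsBigO.of_bound (‖agentAct No A‖ ^ 2) (Eventually.of_forall fun Z => ?_)
    simp only [Function.comp, norm_pow, Real.norm_eq_abs, abs_norm, ← mul_pow]
    gcongr
    exact abs_agentAct_coe_le A Z i j
  refine ((optionProjL No).isBigO_comp _ _ |>.trans_isLittleO h1).congr_left fun Z => ?_
  have : (fun j => S ((agentAct No A Z i).1 j) - (agentAct No A Z i).1 j -
      a * (agentAct No A Z i).1 j ^ 2) = (fun j => S ((agentAct No A Z i).1 j)) -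
      (agentAct No A Z i).1 - a • fun j => (agentAct No A Z i).1 j ^ 2 := rfl
  rw [this]
  simp only [map_sub, map_smul, optionProjL_of_mem]
  rfl

theorem projSq_norm_le {No : ℕ} (x : optionSpace No) :
    ‖projSq x‖ ≤ ‖optionProjL No‖ * ‖x‖ ^ 2 := by
  refine ((optionProjL No).le_opNorm _).trans ?_
  gcongr
  refine (pi_norm_le_iff_of_nonneg (by positivity)).2 fun j => ?_
  rw [norm_pow, Real.norm_eq_abs]
  gcongr
  exact abs_coe_le_norm x j

theorem quadResponse_isBigO {Na No : ℕ} (A : Matrix (Fin Na) (Fin Na) ℝ) :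
    (quadResponse A : StateSpace Na No → StateSpace Na No) =O[𝓝 0] fun Z => ‖Z‖ ^ 2 := by
  rw [isBigO_pi]
  intro i
  refine IsBigO.of_bound (‖optionProjL No‖ * ‖agentAct No A‖ ^ 2) (Eventually.of_forall fun Z => ?_)
  refine (projSq_norm_le _).trans ?_
  rw [norm_pow, norm_norm, mul_assoc, ← mul_pow]
  gcongr
  exact (norm_le_pi_norm _ i).trans ((agentAct No A).le_opNorm Z)

theorem netResponse_isLittleO {Na No : ℕ} {S₁ S₂ : ℝ → ℝ} (hS₁ : IsSaturating S₁)
    (hS₂ : IsSaturating S₂) (A B : Matrix (Fin Na) (Fin Na) ℝ) :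
    (fun Z : StateSpace Na No => netResponse S₁ S₂ A B Z - agentAct No (A - B) Z -
      ((iteratedDeriv 2 S₁ 0 / 2) • quadResponse A Z -
        (iteratedDeriv 2 S₂ 0 / 2) • quadResponse B Z)) =o[𝓝 0] fun Z => ‖Z‖ ^ 2 := by
  refine ((response_isLittleO hS₁ A).sub (response_isLittleO hS₂ B)).congr_left fun Z => ?_
  rw [agentAct_sub, netResponse]
  abel

theorem netResponse_isBigO {Na No : ℕ} {S₁ S₂ : ℝ → ℝ} (hS₁ : IsSaturating S₁)
    (hS₂ : IsSaturating S₂) (A B : Matrix (Fin Na) (Fin Na) ℝ) :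
    (fun Z : StateSpace Na No => netResponse S₁ S₂ A B Z - agentAct No (A - B) Z) =O[𝓝 0]
      fun Z => ‖Z‖ ^ 2 := by
  have h := (netResponse_isLittleO (No := No) hS₁ hS₂ A B).isBigO.add
    (((quadResponse_isBigO (No := No) A).const_smul_left (iteratedDeriv 2 S₁ 0 / 2)).sub
    ((quadResponse_isBigO (No := No) B).const_smul_left (iteratedDeriv 2 S₂ 0 / 2)))
  exact h.congr_left fun Z => by simp

theorem response_contDiff {Na No : ℕ} {S : ℝ → ℝ} (hS : IsSaturating S)
    (A : Matrix (Fin Na) (Fin Na) ℝ) :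
    ContDiff ℝ 3 (response S A : StateSpace Na No → StateSpace Na No) := by
  rw [contDiff_pi]
  intro i
  refine (optionProjL No).contDiff.comp (contDiff_pi.2 fun j => hS.contDiff.comp ?_)
  exact ((stateCoord i j).comp (agentAct No A)).contDiff

theorem netResponse_contDiff {Na No : ℕ} {S₁ S₂ : ℝ → ℝ} (hS₁ : IsSaturating S₁)
    (hS₂ : IsSaturating S₂) (A B : Matrix (Fin Na) (Fin Na) ℝ) :
    ContDiff ℝ 3 (netResponse S₁ S₂ A B : StateSpace Na No → StateSpace Na No) :=
  (response_contDiff hS₁ A).sub (response_contDiff hS₂ B)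

theorem response_bounded {Na No : ℕ} {S : ℝ → ℝ} (hS : IsSaturating S)
    (A : Matrix (Fin Na) (Fin Na) ℝ) :
    ∃ C, ∀ Z : StateSpace Na No, ‖response S A Z‖ ≤ C := by
  obtain ⟨k₁, k₂, h₁, h₂, hk⟩ := hS.bounded
  refine ⟨‖optionProjL No‖ * (k₁ + k₂), fun Z => ?_⟩
  refine (pi_norm_le_iff_of_nonneg (by positivity)).2 fun i => ?_
  refine ((optionProjL No).le_opNorm _).trans ?_
  gcongr
  refine (pi_norm_le_iff_of_nonneg (by positivity)).2 fun j => ?_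
  have := hk ((agentAct No A Z i).1 j)
  rw [Real.norm_eq_abs, abs_le]
  constructor <;> linarith [this.1, this.2]

theorem netResponse_bounded {Na No : ℕ} {S₁ S₂ : ℝ → ℝ} (hS₁ : IsSaturating S₁)
    (hS₂ : IsSaturating S₂) (A B : Matrix (Fin Na) (Fin Na) ℝ) :
    ∃ C, 0 ≤ C ∧ ∀ Z : StateSpace Na No, ‖netResponse S₁ S₂ A B Z‖ ≤ C := by
  obtain ⟨C₁, h₁⟩ := response_bounded (No := No) hS₁ A
  obtain ⟨C₂, h₂⟩ := response_bounded (No := No) hS₂ B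
  have h : ∀ Z : StateSpace Na No, ‖netResponse S₁ S₂ A B Z‖ ≤ C₁ + C₂ := fun Z =>
    (norm_sub_le _ _).trans (add_le_add (h₁ Z) (h₂ Z))
  exact ⟨C₁ + C₂, (norm_nonneg _).trans (h 0), h⟩

theorem netResponse_zero {Na No : ℕ} {S₁ S₂ : ℝ → ℝ} (hS₁ : IsSaturating S₁)
    (hS₂ : IsSaturating S₂) (A B : Matrix (Fin Na) (Fin Na) ℝ) :
    netResponse S₁ S₂ A B (0 : StateSpace Na No) = 0 := by
  funext i
  simp [netResponse, response, hS₁.map_zero, hS₂.map_zero, optionProjL_const]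

/-! ### Adapted seminorms -/

section AdaptedSeminorm

variable {E : Type*} [NormedAddCommGroup E] [NormedSpace ℝ E]

/-- The seminorm `p` is equivalent to the norm and the linear field `L` has logarithmic norm at most
`c` with respect to `p`. -/
structure IsAdapted (p : Seminorm ℝ E) (L : E →L[ℝ] E) (c C : ℝ) : Prop where
  pos : 0 < C
  norm_le : ∀ x, ‖x‖ ≤ p x
  le_norm : ∀ x, p x ≤ C * ‖x‖
  step : ∃ h > 0, ∀ x, p (x + h • L x) ≤ (1 + h * c) * p x

/-- Renorming by `p x = ∑_{k<n} ρ⁻ᵏ ‖Tᵏ x‖`: applying `T` shifts the sum, and the new last term `ρ⁻ⁿ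
‖Tⁿ x‖` is at most the lost first term `‖x‖`. The family `P` stands for the powers of `T`, so that
it can be given by powers of a matrix. -/
theorem exists_seminorm_of_norm_pow_le (T : E →L[ℝ] E) (P : ℕ → E →L[ℝ] E)
    (hP0 : ∀ x, P 0 x = x) (hP : ∀ k x, P (k + 1) x = P k (T x)) {ρ : ℝ} (hρ : 0 < ρ) {n : ℕ}
    (hn : 0 < n) (hT : ‖P n‖ ≤ ρ ^ n) :
    ∃ p : Seminorm ℝ E, ∃ C > 0, (∀ x, ‖x‖ ≤ p x) ∧ (∀ x, p x ≤ C * ‖x‖) ∧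
      ∀ x, p (T x) ≤ ρ * p x := by
  let p : Seminorm ℝ E := Seminorm.of (fun x => ∑ k ∈ Finset.range n, ρ⁻¹ ^ k * ‖P k x‖)
    (by
      intro x y
      rw [← Finset.sum_add_distrib]
      refine Finset.sum_le_sum fun k _ => ?_
      rw [← mul_add, map_add]
      gcongr
      exact norm_add_le _ _)
    (by
      intro a x
      rw [Finset.mul_sum]
      refine Finset.sum_congr rfl fun k _ => ?_
      rw [map_smul, norm_smul]
      ring)
  have hp : ∀ x, p x = ∑ k ∈ Finset.range n, ρ⁻¹ ^ k * ‖P k x‖ := fun _ => rfl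
  -- The summand `1` only makes the constant positive.
  refine ⟨p, ∑ k ∈ Finset.range n, ρ⁻¹ ^ k * ‖P k‖ + 1, by positivity, fun x => ?_, fun x => ?_,
    fun x => ?_⟩
  · rw [hp]
    have := Finset.single_le_sum (f := fun k => ρ⁻¹ ^ k * ‖P k x‖)
      (fun k _ => by positivity) (Finset.mem_range.2 hn)
    simpa [hP0] using this
  · rw [hp, add_mul, Finset.sum_mul, one_mul]
    have : ∑ k ∈ Finset.range n, ρ⁻¹ ^ k * ‖P k x‖ ≤
        ∑ k ∈ Finset.range n, ρ⁻¹ ^ k * ‖P k‖ * ‖x‖ := by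
      refine Finset.sum_le_sum fun k _ => ?_
      rw [mul_assoc]
      gcongr
      exact (P k).le_opNorm x
    linarith [norm_nonneg x]
  · have h2 : ρ⁻¹ ^ n * ‖P n x‖ ≤ ‖x‖ := by
      have := ((P n).le_opNorm x).trans (mul_le_mul_of_nonneg_right hT (norm_nonneg x))
      calc ρ⁻¹ ^ n * ‖P n x‖ ≤ ρ⁻¹ ^ n * (ρ ^ n * ‖x‖) := by gcongr
        _ = ‖x‖ := by
          rw [← mul_assoc, ← mul_pow, inv_mul_cancel₀ hρ.ne', one_pow, one_mul]
    have h3 := Finset.sum_range_succ' (fun k => ρ⁻¹ ^ k * ‖P k x‖) n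
    have h4 := Finset.sum_range_succ (fun k => ρ⁻¹ ^ k * ‖P k x‖) n
    have h5 : p (T x) = ρ * ∑ k ∈ Finset.range n, ρ⁻¹ ^ (k + 1) * ‖P (k + 1) x‖ := by
      rw [hp, Finset.mul_sum]
      refine Finset.sum_congr rfl fun k _ => ?_
      rw [hP, pow_succ ρ⁻¹]
      field_simp
    rw [h5, hp]
    refine mul_le_mul_of_nonneg_left ?_ hρ.le
    simp only [pow_zero, one_mul, hP0] at h3
    linarith

end AdaptedSeminorm

/-- The difference of the squares is `t (2 (c - Re μ) + O(t))`, positive for small `t > 0`. -/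
theorem eventually_norm_one_add_mul_lt {μ : ℂ} {c : ℝ} (h : μ.re < c) :
    ∀ᶠ t : ℝ in 𝓝[>] 0, ‖1 + (t : ℂ) * μ‖ < 1 + t * c := by
  have h1 : ∀ᶠ t : ℝ in 𝓝 0, 0 < 1 + t * c := by
    have : Continuous fun t : ℝ => 1 + t * c := by fun_prop
    exact this.tendsto 0 |>.eventually (lt_mem_nhds (by simp))
  have h2 : ∀ᶠ t : ℝ in 𝓝 0, 0 < 2 * (c - μ.re) + t * (c ^ 2 - μ.re ^ 2 - μ.im ^ 2) := by
    have : Continuous fun t : ℝ => 2 * (c - μ.re) + t * (c ^ 2 - μ.re ^ 2 - μ.im ^ 2) := by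
      fun_prop
    exact this.tendsto 0 |>.eventually (lt_mem_nhds (by simpa using h))
  filter_upwards [nhdsWithin_le_nhds h1, nhdsWithin_le_nhds h2, self_mem_nhdsWithin]
    with t ht1 ht2 ht3
  have ht3 : 0 < t := ht3
  refine lt_of_pow_lt_pow_left₀ 2 ht1.le ?_
  rw [Complex.sq_norm, Complex.normSq_apply]
  simp only [Complex.add_re, Complex.one_re, Complex.mul_re, Complex.ofReal_re, Complex.ofReal_im,
    Complex.add_im, Complex.one_im, Complex.mul_im]
  nlinarith [mul_pos ht3 ht2]

theorem spectrum_one_add_smul {A : Type*} [Ring A] [Algebra ℂ A] {a : A} {h : ℂ} (hh : h ≠ 0)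
    {z : ℂ} (hz : z ∈ spectrum ℂ (1 + h • a)) : (z - 1) / h ∈ spectrum ℂ a := by
  have e : z = (z - 1) + 1 := by ring
  rw [← map_one (algebraMap ℂ A), e, spectrum.add_mem_add_iff] at hz
  have e2 : z - 1 = Units.mk0 h hh • ((z - 1) / h) := by
    rw [Units.smul_def, Units.val_mk0, smul_eq_mul, mul_div_cancel₀ _ hh]
  rw [e2, show h • a = Units.mk0 h hh • a from rfl, spectrum.smul_mem_smul_iff] at hz
  exact hz

/-- Finiteness of the spectrum lets one step size `h` serve all eigenvalues, so `1 + h a` has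
spectral radius below `1 + h c`. Gelfand's formula turns this into a bound on some power. -/
theorem exists_norm_one_add_smul_pow_le {A : Type*} [NormedRing A] [NormedAlgebra ℂ A]
    [CompleteSpace A] [Nontrivial A] (a : A) (hfin : (spectrum ℂ a).Finite) {c : ℝ}
    (hc : ∀ μ ∈ spectrum ℂ a, μ.re < c) :
    ∃ h > (0 : ℝ), 0 < 1 + h * c ∧ ∃ n > 0, ‖(1 + (h : ℂ) • a) ^ n‖ ≤ (1 + h * c) ^ n := by
  have h1 : ∀ᶠ t : ℝ in 𝓝[>] 0, ∀ μ ∈ spectrum ℂ a, ‖1 + (t : ℂ) * μ‖ < 1 + t * c :=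
    (eventually_all_finite hfin).2 fun μ hμ => eventually_norm_one_add_mul_lt (hc μ hμ)
  have h2 : ∀ᶠ t : ℝ in 𝓝[>] 0, 0 < 1 + t * c := by
    have : Continuous fun t : ℝ => 1 + t * c := by fun_prop
    exact nhdsWithin_le_nhds (this.tendsto 0 |>.eventually (lt_mem_nhds (by simp)))
  obtain ⟨h, ⟨hh1, hh2⟩, hh⟩ := ((h1.and h2).and self_mem_nhdsWithin).exists
  have hh : 0 < h := hh
  have hu : (h : ℂ) ≠ 0 := by exact_mod_cast hh.ne'
  refine ⟨h, hh, hh2, ?_⟩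
  have hspec : ∀ z ∈ spectrum ℂ (1 + (h : ℂ) • a), ‖z‖₊ < (1 + h * c).toNNReal := by
    intro z hz
    have := hh1 _ (spectrum_one_add_smul hu hz)
    rw [mul_div_cancel₀ _ hu, add_sub_cancel] at this
    rw [← NNReal.coe_lt_coe, Real.coe_toNNReal _ hh2.le]
    exact this
  have hsr := spectrum.spectralRadius_lt_of_forall_lt _ hspec
  have hg := spectrum.pow_nnnorm_pow_one_div_tendsto_nhds_spectralRadius (1 + (h : ℂ) • a)
  obtain ⟨n, hn, hn0⟩ := ((hg.eventually (gt_mem_nhds hsr)).and (eventually_gt_atTop 0)).exists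
  refine ⟨n, hn0, ?_⟩
  have hn' : (0 : ℝ) < n := by exact_mod_cast hn0
  have h3 := ENNReal.rpow_lt_rpow hn hn'
  rw [← ENNReal.rpow_mul, one_div_mul_cancel hn'.ne', ENNReal.rpow_one,
    ENNReal.rpow_natCast] at h3
  have h4 : ‖(1 + (h : ℂ) • a) ^ n‖₊ < (1 + h * c).toNNReal ^ n := by exact_mod_cast h3
  have h5 := NNReal.coe_lt_coe.2 h4
  rw [NNReal.coe_pow, Real.coe_toNNReal _ hh2.le] at h5
  exact h5.le

/-! ### Adapted seminorms for matrices acting on the agents -/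

section Matrix

attribute [local instance] Matrix.linftyOpNormedRing Matrix.linftyOpNormedAlgebra
  Matrix.linftyOpNormedAddCommGroup Matrix.linftyOpNormedSpace

/-- The row-sum norm of the complexified matrix dominates the action on the sup-normed product; this
carries the complex spectral estimate over to the real state space. -/
theorem norm_agentAct_le {Na : ℕ} (No : ℕ) (P : Matrix (Fin Na) (Fin Na) ℝ) :
    ‖agentAct No P‖ ≤ ‖P.map Complex.ofReal‖ := by
  refine ContinuousLinearMap.opNorm_le_bound _ (norm_nonneg _) fun Z => ?_
  refine (pi_norm_le_iff_of_nonneg (by positivity)).2 fun i => ?_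
  rw [agentAct_apply]
  refine (norm_sum_le _ _).trans ?_
  have h : ∑ k, ‖P i k‖ ≤ ‖P.map Complex.ofReal‖ := by
    rw [Matrix.linfty_opNorm_def]
    have := Finset.le_sup (f := fun i => ∑ j, ‖(P.map Complex.ofReal) i j‖₊) (Finset.mem_univ i)
    have h2 : (∑ j, ‖(P.map Complex.ofReal) i j‖₊ : NNReal) ≤ _ := this
    refine le_trans (le_of_eq ?_) (NNReal.coe_le_coe.2 h2)
    simp
  calc ∑ k, ‖P i k • Z k‖ ≤ ∑ k, ‖P i k‖ * ‖Z‖ := by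
        refine Finset.sum_le_sum fun k _ => ?_
        rw [norm_smul]
        gcongr
        exact norm_le_pi_norm Z k
    _ ≤ _ := by
        rw [← Finset.sum_mul]
        gcongr

theorem exists_adapted {Na : ℕ} [Nonempty (Fin Na)] (No : ℕ) (L : Matrix (Fin Na) (Fin Na) ℝ)
    {c : ℝ} (hc : ∀ μ ∈ spectrum ℂ (L.map Complex.ofReal), μ.re < c) :
    ∃ (p : Seminorm ℝ (StateSpace Na No)) (C : ℝ), IsAdapted p (agentAct No L) c C := by
  obtain ⟨h, hh, hρ, n, hn, hle⟩ :=
    exists_norm_one_add_smul_pow_le (L.map Complex.ofReal) (Matrix.finite_spectrum _) hc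
  have e1 : (1 + h • L).map Complex.ofReal = 1 + (h : ℂ) • L.map Complex.ofReal := by
    ext i j
    by_cases hij : i = j <;> simp [hij]
  have e2 : ((1 + h • L) ^ n).map Complex.ofReal = (1 + (h : ℂ) • L.map Complex.ofReal) ^ n := by
    rw [← e1]
    exact Matrix.map_pow (1 + h • L) Complex.ofRealHom n
  obtain ⟨p, C, hC, hp1, hp2, hp3⟩ := exists_seminorm_of_norm_pow_le (agentAct No (1 + h • L))
    (fun k => agentAct No ((1 + h • L) ^ k)) (fun x => by simp [agentAct_one])
    (fun k x => by rw [pow_succ, agentAct_mul]) hρ hn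
    ((norm_agentAct_le No _).trans (by rw [e2]; exact hle))
  refine ⟨p, C, hC, hp1, hp2, h, hh, fun x => ?_⟩
  have := hp3 x
  rwa [agentAct_add, agentAct_one, agentAct_smul] at this

end Matrix

/-! ### Stability and instability from the linearization -/

section Linearization

variable {E : Type*} [NormedAddCommGroup E] [NormedSpace ℝ E]

/-- For `τ ≤ h` the point `W + τ L W` is a convex combination of `W` and `W + h L W`, so the bound
at the single step `h` implies `p (W + τ L W) ≤ (1 + τ c) p W`. Hence the upper right derivative of
`p` along `W` is at most `c p W + p R`, in the form required by the comparison theorem for barriers.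
-/
theorem IsAdapted.frequently_slope_lt {p : Seminorm ℝ E} {L : E →L[ℝ] E} {c C : ℝ}
    (hp : IsAdapted p L c C) {W : ℝ → E} {t : ℝ} {R : E}
    (hW : HasDerivWithinAt W (L (W t) + R) (Ici t) t) (r : ℝ) (hr : c * p (W t) + p R < r) :
    ∃ᶠ z in 𝓝[>] t, slope (fun t => p (W t)) t z < r := by
  obtain ⟨h, hh, hstep⟩ := hp.step
  set ε := (r - (c * p (W t) + p R)) / (2 * C) with hε
  have hC := hp.pos
  have hε0 : 0 < ε := by
    have : 0 < r - (c * p (W t) + p R) := by linarith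
    positivity
  have hCε : C * ε = (r - (c * p (W t) + p R)) / 2 := by
    rw [hε]
    field_simp
  have h1 := (hasDerivWithinAt_iff_isLittleO.1 hW).def hε0
  have h1' := nhdsWithin_mono t Ioi_subset_Ici_self h1
  have h2 : ∀ᶠ z in 𝓝[>] t, z < t + h := nhdsWithin_le_nhds (gt_mem_nhds (by linarith))
  refine Eventually.frequently ?_
  filter_upwards [h1', h2, self_mem_nhdsWithin] with z hz1 hz2 hz3
  have hz3 : t < z := hz3
  set τ := z - t with hτ
  have hτ0 : 0 < τ := by linarith
  have hz1 : ‖W z - W t - τ • (L (W t) + R)‖ ≤ ε * ‖τ‖ := hz1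
  rw [Real.norm_eq_abs, abs_of_pos hτ0] at hz1
  rw [slope_def_field, div_lt_iff₀ hτ0]
  have e : W z = ((1 - τ / h) • W t + (τ / h) • (W t + h • L (W t))) + τ • R +
      (W z - W t - τ • (L (W t) + R)) := by
    have : (τ / h) • (h • L (W t)) = τ • L (W t) := by
      rw [smul_smul, div_mul_cancel₀ _ hh.ne']
    rw [smul_add, this, sub_smul, one_smul, smul_add]
    abel
  have hτh : τ / h ≤ 1 := by
    rw [div_le_one hh]
    linarith
  have b1 : p ((1 - τ / h) • W t + (τ / h) • (W t + h • L (W t))) ≤ (1 + τ * c) * p (W t) := by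
    refine (map_add_le_add p _ _).trans ?_
    rw [map_smul_eq_mul, map_smul_eq_mul, Real.norm_eq_abs, Real.norm_eq_abs,
      abs_of_nonneg (by linarith), abs_of_nonneg (by positivity)]
    have := mul_le_mul_of_nonneg_left (hstep (W t)) (show 0 ≤ τ / h by positivity)
    refine (add_le_add_right this _).trans (le_of_eq ?_)
    field_simp
    ring
  have b2 : p (τ • R) = τ * p R := by
    rw [map_smul_eq_mul, Real.norm_eq_abs, abs_of_pos hτ0]
  have b3 := (hp.le_norm _).trans (mul_le_mul_of_nonneg_left hz1 hC.le)
  have b4 : p (W z) ≤ (1 + τ * c) * p (W t) + τ * p R + C * (ε * τ) := by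
    calc p (W z) = p (((1 - τ / h) • W t + (τ / h) • (W t + h • L (W t))) + τ • R +
          (W z - W t - τ • (L (W t) + R))) := congrArg p e
      _ ≤ p ((1 - τ / h) • W t + (τ / h) • (W t + h • L (W t))) + p (τ • R) +
          p (W z - W t - τ • (L (W t) + R)) :=
        (map_add_le_add p _ _).trans (add_le_add_left (map_add_le_add p _ _) _)
      _ ≤ _ := by rw [b2]; gcongr
  have b5 : C * (ε * τ) = (r - (c * p (W t) + p R)) / 2 * τ := by
    rw [← mul_assoc, hCε]
  have : 0 < (r - (c * p (W t) + p R)) * τ := mul_pos (by linarith) hτ0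
  nlinarith

theorem IsSolutionOn.hasDerivWithinAt_Ici {f : E → E} {T : ℝ} {Z : ℝ → E}
    (hZ : IsSolutionOn f T Z) {t : ℝ} (ht : t ∈ Ico 0 T) :
    HasDerivWithinAt Z (f (Z t)) (Ici t) t :=
  (hZ t (Ico_subset_Icc_self ht)).mono_of_mem_nhdsWithin (Icc_mem_nhdsGE_of_mem ht)

theorem IsSolutionOn.continuousOn {f : E → E} {T : ℝ} {Z : ℝ → E} (hZ : IsSolutionOn f T Z) :
    ContinuousOn Z (Icc 0 T) :=
  fun t ht => (hZ t ht).continuousWithinAt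

theorem IsAdapted.continuous {p : Seminorm ℝ E} {L : E →L[ℝ] E} {c C : ℝ}
    (hp : IsAdapted p L c C) : Continuous p :=
  Seminorm.continuous_of_le (q := (C.toNNReal) • normSeminorm ℝ E)
    (by
      have : Continuous fun x : E => C.toNNReal • ‖x‖ := by fun_prop
      exact this)
    (fun x => by
      have := hp.le_norm x
      rw [← Real.coe_toNNReal C hp.pos.le] at this
      exact this)

theorem exists_quadratic_bound {E : Type*} [NormedAddCommGroup E] {f : E → E} {L : E → E}
    (hf : (fun x => f x - L x) =O[𝓝 0] fun x => ‖x‖ ^ 2) :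
    ∃ K > 0, ∃ δ > 0, ∀ x, ‖x‖ ≤ δ → ‖f x - L x‖ ≤ K * ‖x‖ ^ 2 := by
  obtain ⟨K, hK, hb⟩ := hf.exists_pos
  rw [IsBigOWith, Metric.eventually_nhds_iff_ball] at hb
  obtain ⟨δ, hδ, hb⟩ := hb
  refine ⟨K, hK, δ / 2, by positivity, fun x hx => ?_⟩
  have := hb x (by rw [mem_ball_zero_iff]; linarith)
  simpa using this

/-- The principle of linearized stability. -/
theorem IsAdapted.isLocallyExpStable {p : Seminorm ℝ E} {L : E →L[ℝ] E} {c C : ℝ}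
    (hp : IsAdapted p L c C) (hc : c < 0) {f : E → E}
    (hf : (fun x => f x - L x) =O[𝓝 0] fun x => ‖x‖ ^ 2) : IsLocallyExpStable f := by
  obtain ⟨K, hK, δ, hδ, hb⟩ := exists_quadratic_bound hf
  have hC := hp.pos
  set κ := -c / 2 with hκ
  have hκ0 : 0 < κ := by linarith
  -- Inside radius `a₀` the quadratic bound is available and the remainder is below `κ p`. As `c =
  -- -2κ`, the net rate is still below `-κ`.
  set a₀ := min δ (κ / (2 * (C * K))) with ha₀
  have ha₀0 : 0 < a₀ := by positivity
  have ha₀1 : a₀ ≤ δ := min_le_left _ _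
  have ha₀2 : C * K * a₀ < κ := by
    have : a₀ ≤ κ / (2 * (C * K)) := min_le_right _ _
    rw [le_div_iff₀ (by positivity)] at this
    linarith
  refine ⟨a₀ / C, by positivity, C, hC, κ, hκ0, fun T Z hZ hZ0 t ht => ?_⟩
  have hp0 : p (Z 0) < a₀ := by
    rw [lt_div_iff₀ hC] at hZ0
    linarith [hp.le_norm (Z 0)]
  -- Starting the barrier strictly above `p (Z 0)` gives `p > 0` at any contact, hence a strict
  -- derivative inequality there, even if `Z 0 = 0`. Letting `a ↓ p (Z 0)` afterwards restores the
  -- initial value.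
  have key : ∀ a, p (Z 0) < a → a ≤ a₀ → p (Z t) ≤ a * Real.exp (-κ * t) := by
    intro a ha1 ha2
    have ha0 : 0 < a := (apply_nonneg p _).trans_lt ha1
    refine image_le_of_liminf_slope_right_lt_deriv_boundary (f := fun t => p (Z t))
      (f' := fun t => c * p (Z t) + p (f (Z t) - L (Z t))) (B := fun t => a * Real.exp (-κ * t))
      (B' := fun t => a * (Real.exp (-κ * t) * -κ))
      (hp.continuous.comp_continuousOn hZ.continuousOn) ?_ ?_ ?_ ?_ ht
    · intro s hs r hr
      refine hp.frequently_slope_lt (R := f (Z s) - L (Z s)) ?_ r hr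
      rw [add_sub_cancel]
      exact hZ.hasDerivWithinAt_Ici hs
    · simpa using ha1.le
    · intro s
      have h1 : HasDerivAt (fun t => -κ * t) (-κ) s := by
        simpa using (hasDerivAt_id s).const_mul (-κ)
      exact h1.exp.const_mul a
    · intro s hs hEq
      have hEq : p (Z s) = a * Real.exp (-κ * s) := hEq
      have hexp : Real.exp (-κ * s) ≤ 1 := Real.exp_le_one_iff.2 (by nlinarith [hs.1])
      have hps : p (Z s) ≤ a₀ := by
        rw [hEq]
        nlinarith [Real.exp_pos (-κ * s)]
      have hps0 : 0 < p (Z s) := by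
        rw [hEq]
        positivity
      have hn := hp.norm_le (Z s)
      have hR : p (f (Z s) - L (Z s)) ≤ C * K * a₀ * p (Z s) := by
        refine (hp.le_norm _).trans ?_
        rw [mul_assoc C, mul_assoc C]
        gcongr
        refine (hb _ (by linarith)).trans ?_
        rw [mul_assoc K]
        gcongr
        rw [sq]
        gcongr
        linarith
      have : a * (Real.exp (-κ * s) * -κ) = -κ * p (Z s) := by
        rw [hEq]
        ring
      rw [this]
      have hck : c = -2 * κ := by rw [hκ]; ring
      rw [hck]
      nlinarith
  have hlim : p (Z t) ≤ p (Z 0) * Real.exp (-κ * t) := by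
    have hcont : Tendsto (fun a : ℝ => a * Real.exp (-κ * t)) (𝓝[>] (p (Z 0)))
        (𝓝 (p (Z 0) * Real.exp (-κ * t))) := by
      have : Continuous fun a : ℝ => a * Real.exp (-κ * t) := by fun_prop
      exact (this.tendsto _).mono_left nhdsWithin_le_nhds
    refine ge_of_tendsto hcont ?_
    filter_upwards [Ioc_mem_nhdsGT hp0] with a ha
    exact key a ha.1 ha.2
  calc ‖Z t‖ ≤ p (Z t) := hp.norm_le _
    _ ≤ p (Z 0) * Real.exp (-κ * t) := hlim
    _ ≤ C * ‖Z 0‖ * Real.exp (-κ * t) := by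
      gcongr
      exact hp.le_norm _
    _ = _ := by ring

/-- The principle of linearized instability: a positive eigenvalue `μ` such that the growth rate of
the linearization is below `2 * μ`. -/
theorem IsAdapted.not_isLyapunovStable {p : Seminorm ℝ E} {L : E →L[ℝ] E} {c C μ : ℝ}
    (hp : IsAdapted p L c C) (hμ : 0 < μ) (hc : c < 2 * μ) {e : E} (he : e ≠ 0)
    (hLe : L e = μ • e) {f : E → E} (hf : (fun x => f x - L x) =O[𝓝 0] fun x => ‖x‖ ^ 2)
    (hex : ∀ (x : E) (T : ℝ), 0 ≤ T → ∃ Z, Z 0 = x ∧ IsSolutionOn f T Z) :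
    ¬ IsLyapunovStable f := by
  wlog hpe : p e = 1 generalizing e
  · have hpe0 : 0 < p e := (norm_pos_iff.2 he).trans_le (hp.norm_le e)
    refine this (e := (p e)⁻¹ • e) (smul_ne_zero (inv_ne_zero hpe0.ne') he) ?_ ?_
    · rw [map_smul, hLe, smul_comm]
    · rw [map_smul_eq_mul, Real.norm_eq_abs, abs_of_pos (by positivity),
        inv_mul_cancel₀ hpe0.ne']
  intro hstab
  obtain ⟨K, hK, δ, hδ, hb⟩ := exists_quadratic_bound hf
  have hC := hp.pos
  have hgap : 0 < 2 * μ - c := by linarith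
  -- With `g = η e^{μt}`, the deviation from the linear mode is to stay below the barrier `Q g²`. At
  -- contact its rate is at most `c Q g² + 4 C K g²`, and this choice of `Q` puts that below `2μ Q
  -- g²`, the rate of the barrier.
  set Q := (4 * C * K + 1) / (2 * μ - c) with hQ
  have hQ0 : 0 < Q := by positivity
  have hQgap : Q * (2 * μ - c) = 4 * C * K + 1 := by
    rw [hQ]
    field_simp
  -- While `g ≤ θ`, the solution stays in the region of the quadratic bound, since `p (Z) ≤ 2 g ≤
  -- δ`, and the deviation is at most `g / 2`.
  set θ := min (δ / 2) (1 / (2 * Q)) with hθ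
  have hθ0 : 0 < θ := by positivity
  have hθ1 : 2 * θ ≤ δ := by
    have : θ ≤ δ / 2 := min_le_left _ _
    linarith
  have hθ2 : Q * θ ≤ 1 / 2 := by
    have : θ ≤ 1 / (2 * Q) := min_le_right _ _
    rw [le_div_iff₀ (by positivity)] at this
    linarith
  obtain ⟨r, hr, hst⟩ := hstab (θ / (2 * C)) (by positivity)
  have hen : 0 < ‖e‖ := norm_pos_iff.2 he
  obtain ⟨η, hη0, hη⟩ := exists_between (show 0 < min θ (r / ‖e‖) by positivity)
  have hηθ : η < θ := hη.trans_le (min_le_left _ _)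
  have hηr : η * ‖e‖ < r := by
    rw [← lt_div_iff₀ hen]
    exact hη.trans_le (min_le_right _ _)
  -- The time at which the linear mode `η e^{μt}` reaches size `θ`, which does not depend on the
  -- initial radius `r`.
  set T := Real.log (θ / η) / μ with hT
  have hT0 : 0 ≤ T := by
    refine div_nonneg (Real.log_nonneg ?_) hμ.le
    rw [le_div_iff₀ hη0]
    linarith
  have hexpT : η * Real.exp (μ * T) = θ := by
    rw [hT, mul_div_cancel₀ _ hμ.ne', Real.exp_log (by positivity)]
    field_simp
  obtain ⟨Z, hZ0, hZ⟩ := hex (η • e) T hT0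
  set W : ℝ → E := fun t => Z t - (η * Real.exp (μ * t)) • e with hW
  have hexpd : ∀ t, HasDerivAt (fun t => Real.exp (μ * t)) (Real.exp (μ * t) * μ) t := by
    intro t
    have h1 : HasDerivAt (fun t => μ * t) μ t := by
      simpa using (hasDerivAt_id t).const_mul μ
    exact h1.exp
  have hfin : p (W T) ≤ Q * η ^ 2 * Real.exp (μ * T) ^ 2 := by
    refine image_le_of_liminf_slope_right_lt_deriv_boundary (f := fun t => p (W t))
      (f' := fun t => c * p (W t) + p (f (Z t) - L (Z t)))
      (B := fun t => Q * η ^ 2 * Real.exp (μ * t) ^ 2)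
      (B' := fun t => Q * η ^ 2 * (2 * Real.exp (μ * t) * (Real.exp (μ * t) * μ)))
      (hp.continuous.comp_continuousOn (hZ.continuousOn.sub (by fun_prop))) ?_ ?_ ?_ ?_
      (right_mem_Icc.2 hT0)
    · intro s hs r hr
      refine hp.frequently_slope_lt (R := f (Z s) - L (Z s)) ?_ r hr
      have h1 := (hZ.hasDerivWithinAt_Ici hs).sub
        (((hexpd s).const_mul η).smul_const e).hasDerivWithinAt
      refine h1.congr_deriv ?_
      simp only [hW, map_sub, map_smul, hLe, smul_smul]
      rw [mul_assoc]
      abel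
    · simp only [hW, hZ0, mul_zero, Real.exp_zero, mul_one, sub_self, map_zero]
      positivity
    · intro s
      have := ((hexpd s).pow 2).const_mul (Q * η ^ 2)
      simpa using this
    · intro s hs hEq
      have hEq : p (W s) = Q * η ^ 2 * Real.exp (μ * s) ^ 2 := hEq
      set g := η * Real.exp (μ * s) with hg
      have hg0 : 0 < g := by positivity
      have hgθ : g ≤ θ := by
        rw [← hexpT, hg]
        gcongr
        exact hs.2.le
      have hEq' : p (W s) = Q * g ^ 2 := by
        rw [hEq, hg]
        ring
      have hZs : p (Z s) ≤ 2 * g := by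
        have e1 : Z s = W s + g • e := by simp [hW, hg]
        rw [e1]
        refine (map_add_le_add p _ _).trans ?_
        rw [map_smul_eq_mul, hpe, hEq', Real.norm_eq_abs, abs_of_pos hg0]
        nlinarith
      have hn := hp.norm_le (Z s)
      have hR : p (f (Z s) - L (Z s)) ≤ C * (K * (2 * g) ^ 2) := by
        refine (hp.le_norm _).trans ?_
        gcongr
        refine (hb _ (by linarith)).trans ?_
        gcongr
        linarith
      have e2 : Q * η ^ 2 * (2 * Real.exp (μ * s) * (Real.exp (μ * s) * μ)) =
          2 * μ * (Q * g ^ 2) := by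
        rw [hg]
        ring
      rw [e2, hEq']
      nlinarith [sq_pos_of_pos hg0]
  have hfin' : p (W T) ≤ θ / 2 := by
    have e1 : Q * η ^ 2 * Real.exp (μ * T) ^ 2 = Q * θ * θ := by
      rw [← hexpT]
      ring
    rw [e1] at hfin
    nlinarith
  have hlow : θ ≤ p (Z T) + p (W T) := by
    have e1 : θ • e = Z T - W T := by simp [hW, hexpT]
    have e2 : p (θ • e) = θ := by
      rw [map_smul_eq_mul, hpe, Real.norm_eq_abs, abs_of_pos hθ0, mul_one]
    rw [← e2, e1]
    exact map_sub_le_add p _ _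
  have hsmall := hst T Z hZ (by
    rw [hZ0, norm_smul, Real.norm_eq_abs, abs_of_pos hη0]
    exact hηr) T (right_mem_Icc.2 hT0)
  rw [lt_div_iff₀ (by positivity)] at hsmall
  nlinarith [hp.le_norm (Z T)]

end Linearization

/-! ### Global existence -/

/-- Solutions of `Ż = -d Z + N(Z)` with `N` bounded and `C¹` exist on every time interval. -/
theorem exists_isSolutionOn {E : Type*} [NormedAddCommGroup E] [NormedSpace ℝ E]
    [FiniteDimensional ℝ E] {N : E → E} (hN : ContDiff ℝ 1 N) {C : ℝ} (hC : 0 ≤ C)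
    (hNC : ∀ x, ‖N x‖ ≤ C) {d : ℝ} (hd : 0 < d) (x : E) (T : ℝ) (hT : 0 ≤ T) :
    ∃ Z : ℝ → E, Z 0 = x ∧ IsSolutionOn (fun z => -(d • z) + N z) T Z := by
  have : CompleteSpace E := FiniteDimensional.complete ℝ E
  have : ProperSpace E := FiniteDimensional.proper ℝ E
  set B := Real.exp (d * T) * C with hB
  have hB0 : 0 ≤ B := by positivity
  obtain ⟨K, hK⟩ : ∃ K, LipschitzOnWith K N (Metric.closedBall 0 (‖x‖ + B * T)) :=
    hN.contDiffOn.exists_lipschitzOnWith one_ne_zero (convex_closedBall _ _)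
      (isCompact_closedBall _ _)
  -- The integrating factor `Y = e^{dt} Z` removes the linear term. The new field is bounded by `B`
  -- on `[0, T]`, so solutions stay in the ball of radius `B T` and Picard–Lindelöf covers the whole
  -- interval.
  let g : ℝ → E → E := fun t y => Real.exp (d * t) • N (Real.exp (-(d * t)) • y)
  have hNc := hN.continuous
  have hmaps : ∀ t ∈ Icc 0 T, ∀ y ∈ Metric.closedBall x (B * T),
      Real.exp (-(d * t)) • y ∈ Metric.closedBall (0 : E) (‖x‖ + B * T) := by
    intro t ht y hy
    rw [mem_closedBall_zero_iff, norm_smul, Real.norm_eq_abs, abs_of_pos (Real.exp_pos _)]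
    rw [mem_closedBall_iff_norm] at hy
    have h1 : Real.exp (-(d * t)) ≤ 1 := Real.exp_le_one_iff.2 (by nlinarith [ht.1])
    have h2 : ‖y‖ ≤ ‖x‖ + B * T := by
      have := norm_add_le x (y - x)
      rw [add_sub_cancel] at this
      linarith
    calc Real.exp (-(d * t)) * ‖y‖ ≤ 1 * ‖y‖ := by gcongr
      _ ≤ _ := by linarith
  have hpl : IsPicardLindelof g (⟨0, left_mem_Icc.2 hT⟩ : Icc 0 T) x
      (B * T).toNNReal 0 B.toNNReal K := by
    have hBT : ((B * T).toNNReal : ℝ) = B * T := Real.coe_toNNReal _ (by positivity)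
    refine ⟨fun t ht => ?_, fun y _ => ?_, fun t ht y _ => ?_, ?_⟩
    · rw [hBT]
      refine LipschitzOnWith.of_dist_le_mul fun y hy y' hy' => ?_
      have := hK.dist_le_mul _ (hmaps t ht y hy) _ (hmaps t ht y' hy')
      rw [dist_smul₀, Real.norm_eq_abs, abs_of_pos (Real.exp_pos _)] at this
      rw [dist_smul₀, Real.norm_eq_abs, abs_of_pos (Real.exp_pos _)]
      refine (mul_le_mul_of_nonneg_left this (Real.exp_pos _).le).trans (le_of_eq ?_)
      rw [Real.exp_neg]
      field_simp
    · have : Continuous fun t => g t y := by fun_prop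
      exact this.continuousOn
    · rw [Real.coe_toNNReal _ hB0, norm_smul, Real.norm_eq_abs, abs_of_pos (Real.exp_pos _), hB]
      gcongr
      · exact ht.2
      · exact hNC _
    · rw [hBT, Real.coe_toNNReal _ hB0]
      simp [hT]
  obtain ⟨Y, hY0, hY⟩ := hpl.exists_eq_forall_mem_Icc_hasDerivWithinAt₀
  refine ⟨fun t => Real.exp (-(d * t)) • Y t, by simpa using hY0, fun t ht => ?_⟩
  have h1 : HasDerivAt (fun t => Real.exp (-(d * t))) (Real.exp (-(d * t)) * -d) t := by
    have : HasDerivAt (fun t => -(d * t)) (-d) t := by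
      simpa using ((hasDerivAt_id t).const_mul d).fun_neg
    exact this.exp
  have h2 := h1.hasDerivWithinAt.smul (hY t ht)
  refine h2.congr_deriv ?_
  simp only [g, smul_smul]
  rw [← Real.exp_add, neg_add_cancel, Real.exp_zero, one_smul, add_comm]
  congr 1
  rw [← neg_smul]
  congr 1
  ring

/-! ### Stability of the neutral state -/

section Neutral

variable {Na No : ℕ} {S₁ S₂ : ℝ → ℝ} {d α β lam : ℝ} {Γ Δ : Matrix (Fin Na) (Fin Na) ℝ}

/-- The matrix whose action on the agents is the linearization at the neutral state. -/
noncomputable def linMatrix (d α β : ℝ) (Γ Δ : Matrix (Fin Na) (Fin Na) ℝ) (u : ℝ) :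
    Matrix (Fin Na) (Fin Na) ℝ :=
  (u * (α - β) - d) • 1 + u • (Γ - Δ)

theorem agentAct_linMatrix (u : ℝ) (Z : StateSpace Na No) :
    agentAct No (linMatrix d α β Γ Δ u) Z =
      -(d • Z) + u • agentAct No ((α • 1 + Γ) - (β • 1 + Δ)) Z := by
  simp only [linMatrix, agentAct_add, agentAct_sub, agentAct_smul, agentAct_one]
  module

theorem homField_sub_isBigO (hS₁ : IsSaturating S₁) (hS₂ : IsSaturating S₂)
    (h : IsAdmissible α β Γ Δ lam) (u : ℝ) :
    (fun Z => homField No S₁ S₂ d α β Γ Δ u Z - agentAct No (linMatrix d α β Γ Δ u) Z) =O[𝓝 0]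
      fun Z => ‖Z‖ ^ 2 := by
  refine ((netResponse_isBigO hS₁ hS₂ (α • 1 + Γ) (β • 1 + Δ)).const_smul_left u).congr_left
    fun Z => ?_
  rw [homField_eq S₁ S₂ d α β h.diag_left h.diag_right, agentAct_linMatrix, Pi.smul_apply, smul_sub]
  abel

/-- The eigenvalues are `u (α - β) - d + u ν` with `ν` an eigenvalue of `Γ - Δ`, and `u > 0`
preserves the order of real parts. -/
theorem re_lt_of_mem_spectrum_linMatrix (h : IsAdmissible α β Γ Δ lam) {u : ℝ} (hu : 0 < u)
    {c : ℝ} (hc : u * (α - β + lam) - d < c) :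
    ∀ μ ∈ spectrum ℂ ((linMatrix d α β Γ Δ u).map Complex.ofReal), μ.re < c := by
  intro μ hμ
  have e : (linMatrix d α β Γ Δ u).map Complex.ofReal =
      algebraMap ℂ _ ((u * (α - β) - d : ℝ) : ℂ) + (u : ℂ) • (Γ - Δ).map Complex.ofReal := by
    rw [Algebra.algebraMap_eq_smul_one]
    ext i j
    by_cases hij : i = j <;> simp [linMatrix, hij]
  have hu' : (u : ℂ) ≠ 0 := by exact_mod_cast hu.ne'
  set c₀ : ℝ := u * (α - β) - d with hc₀
  have e2 : μ = (μ - c₀) + c₀ := by ring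
  rw [e, e2, spectrum.add_mem_add_iff] at hμ
  have e3 : μ - c₀ = Units.mk0 (u : ℂ) hu' • ((μ - c₀) / u) := by
    rw [Units.smul_def, Units.val_mk0, smul_eq_mul, mul_div_cancel₀ _ hu']
  rw [e3, show (u : ℂ) • (Γ - Δ).map Complex.ofReal =
    Units.mk0 (u : ℂ) hu' • (Γ - Δ).map Complex.ofReal from rfl,
    spectrum.smul_mem_smul_iff] at hμ
  have h1 := h.leading.re_le _ hμ
  rw [Complex.div_ofReal_re, div_le_iff₀ hu] at h1
  simp only [Complex.sub_re, Complex.ofReal_re] at h1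
  nlinarith

theorem IsAdmissible.nonempty (h : IsAdmissible α β Γ Δ lam) : Nonempty (Fin Na) := by
  by_contra hne
  rw [not_nonempty_iff] at hne
  have := h.leading.mem
  rw [spectrum.of_subsingleton] at this
  exact this

theorem IsAdmissible.isRoot (h : IsAdmissible α β Γ Δ lam) : (Γ - Δ).charpoly.IsRoot lam := by
  have h1 := h.leading.mem
  rw [Matrix.mem_spectrum_iff_isRoot_charpoly] at h1
  have e : ((Γ - Δ).map Complex.ofReal).charpoly = (Γ - Δ).charpoly.map Complex.ofRealHom :=
    Matrix.charpoly_map (Γ - Δ) Complex.ofRealHom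
  rw [e] at h1
  exact (Polynomial.isRoot_map_iff Complex.ofRealHom.injective).1 h1

theorem exists_mulVec_eq_smul {n : ℕ} {M : Matrix (Fin n) (Fin n) ℝ} {lam : ℝ}
    (h : M.charpoly.IsRoot lam) : ∃ v : Fin n → ℝ, v ≠ 0 ∧ M.mulVec v = lam • v := by
  have h1 : (Matrix.toLin' M).charpoly.IsRoot lam := by rwa [Matrix.charpoly_toLin']
  obtain ⟨v, hv⟩ := ((Module.End.hasEigenvalue_iff_isRoot_charpoly _ _).2 h1).exists_hasEigenvector
  exact ⟨v, hv.2, by simpa using hv.apply_eq_smul⟩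

/-- The vector `e_{j₀} - (1/No) 𝟏`. -/
noncomputable def peakVector {No : ℕ} (j₀ : Fin No) : optionSpace No :=
  optionProjL No (Pi.single j₀ 1)

theorem peakVector_coe {No : ℕ} (j₀ j : Fin No) :
    (peakVector j₀).1 j = (if j = j₀ then 1 else 0) - 1 / (No : ℝ) := by
  rw [peakVector, optionProjL_coe]
  simp [Pi.single_apply]

theorem peakVector_ne_zero (hNo : 2 ≤ No) (j₀ : Fin No) : peakVector j₀ ≠ 0 := by
  intro h
  have h1 : (peakVector j₀).1 j₀ = 0 := by rw [h]; rfl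
  rw [peakVector_coe, if_pos rfl] at h1
  have : (2 : ℝ) ≤ No := by exact_mod_cast hNo
  have h2 : (1 : ℝ) / No < 1 := by
    rw [div_lt_one (by linarith)]
    linarith
  linarith

theorem tensorState_eq_zero {v : Fin Na → ℝ} (hv : v ≠ 0) {x : optionSpace No}
    (h : tensorState No v x = 0) : x = 0 := by
  obtain ⟨i, hi⟩ := Function.ne_iff.1 hv
  have := congrFun h i
  rw [tensorState_apply, Pi.zero_apply] at this
  exact (smul_eq_zero.1 this).resolve_left hi

theorem neutral_isLocallyExpStable (hS₁ : IsSaturating S₁) (hS₂ : IsSaturating S₂)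
    (h : IsAdmissible α β Γ Δ lam) {u : ℝ} (hu : 0 < u) (hu' : u < d / (α - β + lam)) :
    IsLocallyExpStable (homField No S₁ S₂ d α β Γ Δ u) := by
  have := h.nonempty
  rw [lt_div_iff₀ h.pos] at hu'
  -- The rate is half of the negative leading eigenvalue: above the spectrum, still negative.
  obtain ⟨p, C, hp⟩ := exists_adapted No (linMatrix d α β Γ Δ u)
    (re_lt_of_mem_spectrum_linMatrix h hu (c := (u * (α - β + lam) - d) / 2) (by linarith))
  exact hp.isLocallyExpStable (by linarith) (homField_sub_isBigO hS₁ hS₂ h u)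

theorem neutral_not_isLyapunovStable (hNo : 2 ≤ No) (hS₁ : IsSaturating S₁)
    (hS₂ : IsSaturating S₂) (hd : 0 < d) (h : IsAdmissible α β Γ Δ lam) {u : ℝ}
    (hu : d / (α - β + lam) < u) :
    ¬ IsLyapunovStable (homField No S₁ S₂ d α β Γ Δ u) := by
  have := h.nonempty
  have hu0 : 0 < u := (div_pos hd h.pos).trans hu
  rw [div_lt_iff₀ h.pos] at hu
  set μ := u * (α - β + lam) - d with hμ
  have hμ0 : 0 < μ := by linarith
  -- The rate `3/2 μ` lies above the leading eigenvalue `μ` and below `2μ`, as the comparison with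
  -- the growing mode requires.
  obtain ⟨p, C, hp⟩ := exists_adapted No (linMatrix d α β Γ Δ u)
    (re_lt_of_mem_spectrum_linMatrix h hu0 (c := 3 / 2 * μ) (by linarith))
  obtain ⟨v, hv, hMv⟩ := exists_mulVec_eq_smul h.isRoot
  have hx := peakVector_ne_zero hNo ⟨0, by omega⟩
  refine hp.not_isLyapunovStable hμ0 (by linarith)
    (e := tensorState No v (peakVector ⟨0, by omega⟩)) (fun h0 => hx (tensorState_eq_zero hv h0))
    ?_ (homField_sub_isBigO hS₁ hS₂ h u) fun x T hT => ?_
  · rw [agentAct_tensorState]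
    have : (linMatrix d α β Γ Δ u).mulVec v = μ • v := by
      rw [linMatrix, Matrix.add_mulVec, Matrix.smul_mulVec, Matrix.smul_mulVec, hMv,
        Matrix.one_mulVec]
      module
    rw [this]
    funext i
    simp [tensorState_apply, mul_smul]
  · obtain ⟨C, hC, hb⟩ := netResponse_bounded (No := No) hS₁ hS₂ (α • 1 + Γ) (β • 1 + Δ)
    obtain ⟨Z, hZ0, hZ⟩ := exists_isSolutionOn
      (N := fun Z => u • netResponse S₁ S₂ (α • 1 + Γ) (β • 1 + Δ) Z)
      (((netResponse_contDiff hS₁ hS₂ _ _).of_le (by norm_num)).const_smul u)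
      (C := u * C) (by positivity)
      (fun Z => by
        rw [norm_smul, Real.norm_eq_abs, abs_of_pos hu0]
        gcongr
        exact hb Z) hd x T hT
    refine ⟨Z, hZ0, fun t ht => ?_⟩
    rw [homField_eq S₁ S₂ d α β h.diag_left h.diag_right]
    exact hZ t ht

end Neutral

/-! ### Simple eigenvalues -/

section Simple

variable {n : ℕ} {M : Matrix (Fin n) (Fin n) ℝ} {lam : ℝ}

theorem IsSimpleEigenvalue.transpose (h : IsSimpleEigenvalue M lam) :
    IsSimpleEigenvalue M.transpose lam := by
  rw [IsSimpleEigenvalue, Matrix.charpoly_transpose]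
  exact h

theorem IsSimpleEigenvalue.isRoot (h : IsSimpleEigenvalue M lam) : M.charpoly.IsRoot lam := by
  refine (Polynomial.rootMultiplicity_pos (Matrix.charpoly_monic M).ne_zero).1 ?_
  rw [h]
  exact one_pos

/-- The hypothesis says `(M - λ)² y = 0`, and algebraic multiplicity one makes the generalized
eigenspace a line. -/
theorem IsSimpleEigenvalue.exists_eq_smul_of_sq (h : IsSimpleEigenvalue M lam) {v : Fin n → ℝ}
    (hv : v ≠ 0) (hMv : M.mulVec v = lam • v) {y : Fin n → ℝ}
    (hy : M.mulVec (M.mulVec y - lam • y) = lam • (M.mulVec y - lam • y)) : ∃ c : ℝ, y = c • v := by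
  have h1 := LinearMap.finrank_maxGenEigenspace_eq (Matrix.toLin' M) lam
  rw [Matrix.charpoly_toLin', h] at h1
  have hmem : ∀ z : Fin n → ℝ, M.mulVec (M.mulVec z - lam • z) = lam • (M.mulVec z - lam • z) →
      z ∈ Module.End.maxGenEigenspace (Matrix.toLin' M) lam := by
    intro z hz
    rw [Module.End.mem_maxGenEigenspace]
    refine ⟨2, ?_⟩
    rw [pow_two]
    simp only [Module.End.mul_apply, LinearMap.sub_apply, LinearMap.smul_apply,
      Module.End.one_apply, Matrix.toLin'_apply]
    rw [hz, sub_self]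
  have hv' : (⟨v, hmem v (by rw [hMv, sub_self]; simp)⟩ :
      Module.End.maxGenEigenspace (Matrix.toLin' M) lam) ≠ 0 := fun h0 => hv (congrArg Subtype.val h0)
  obtain ⟨c, hc⟩ := (finrank_eq_one_iff_of_nonzero' _ hv').1 h1 ⟨y, hmem y hy⟩
  exact ⟨c, (congrArg Subtype.val hc).symm⟩

theorem IsSimpleEigenvalue.exists_eq_smul (h : IsSimpleEigenvalue M lam) {v : Fin n → ℝ}
    (hv : v ≠ 0) (hMv : M.mulVec v = lam • v) {y : Fin n → ℝ} (hy : M.mulVec y = lam • y) :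
    ∃ c : ℝ, y = c • v :=
  h.exists_eq_smul_of_sq hv hMv (by rw [hy, sub_self]; simp)

theorem dotProduct_self_pos {v : Fin n → ℝ} (hv : v ≠ 0) : 0 < v ⬝ᵥ v :=
  lt_of_le_of_ne (Finset.sum_nonneg fun i _ => mul_self_nonneg (v i))
    (Ne.symm fun h => hv (dotProduct_self_eq_zero.1 h))

theorem dotProduct_mulVec_of_left_eigenvector {l : Fin n → ℝ}
    (hMl : M.transpose.mulVec l = lam • l) (y : Fin n → ℝ) :
    l ⬝ᵥ M.mulVec y = lam * (l ⬝ᵥ y) := by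
  rw [Matrix.dotProduct_mulVec, ← Matrix.mulVec_transpose, hMl, smul_dotProduct, smul_eq_mul]

/-- Left and right eigenvectors of a simple eigenvalue are not orthogonal. -/
theorem IsSimpleEigenvalue.dotProduct_ne_zero (h : IsSimpleEigenvalue M lam) {v l : Fin n → ℝ}
    (hv : v ≠ 0) (hMv : M.mulVec v = lam • v) (hl : l ≠ 0)
    (hMl : M.transpose.mulVec l = lam • l) : l ⬝ᵥ v ≠ 0 := by
  intro hlv
  have hll := dotProduct_self_pos hl
  have hdot := dotProduct_mulVec_of_left_eigenvector hMl
  -- The bordered operator `M - λ + l vᵀ`. Pairing with `l` isolates `(v · y)(l · l)`, so it is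
  -- injective, hence onto. If `l · v = 0`, solving `Φ y = v` yields `(M - λ) y = v`, a Jordan chain
  -- that simplicity excludes.
  let Φ : (Fin n → ℝ) →ₗ[ℝ] (Fin n → ℝ) :=
    { toFun := fun y => M.mulVec y - lam • y + (v ⬝ᵥ y) • l
      map_add' := by
        intro x y
        rw [Matrix.mulVec_add, dotProduct_add]
        module
      map_smul' := by
        intro c x
        rw [Matrix.mulVec_smul, dotProduct_smul, RingHom.id_apply, smul_eq_mul]
        module }
  have hΦ : ∀ y, Φ y = M.mulVec y - lam • y + (v ⬝ᵥ y) • l := fun _ => rfl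
  have hlΦ : ∀ y, l ⬝ᵥ Φ y = (v ⬝ᵥ y) * (l ⬝ᵥ l) := by
    intro y
    rw [hΦ, dotProduct_add, dotProduct_sub, hdot, dotProduct_smul, dotProduct_smul]
    simp
  have hinj : Function.Injective Φ := by
    rw [← LinearMap.ker_eq_bot, LinearMap.ker_eq_bot']
    intro y hy
    have h1 := hlΦ y
    rw [hy, dotProduct_zero] at h1
    have h2 : v ⬝ᵥ y = 0 := (mul_eq_zero.1 h1.symm).resolve_right hll.ne'
    rw [hΦ, h2, zero_smul, add_zero, sub_eq_zero] at hy
    obtain ⟨c, rfl⟩ := h.exists_eq_smul hv hMv hy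
    rw [dotProduct_smul, smul_eq_mul] at h2
    rw [(mul_eq_zero.1 h2).resolve_right (dotProduct_self_pos hv).ne', zero_smul]
  obtain ⟨y, hy⟩ := LinearMap.injective_iff_surjective.1 hinj v
  have h1 := hlΦ y
  rw [hy, hlv] at h1
  have h2 : v ⬝ᵥ y = 0 := (mul_eq_zero.1 h1.symm).resolve_right hll.ne'
  rw [hΦ, h2, zero_smul, add_zero] at hy
  obtain ⟨c, rfl⟩ := h.exists_eq_smul_of_sq hv hMv (y := y) (by rw [hy, hMv])
  rw [Matrix.mulVec_smul, hMv, smul_comm, sub_self] at hy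
  exact hv hy.symm

end Simple

/-! ### Kernel of the linearization and tangency to it -/

section Kernel

/-- Contraction of the agents with a weight vector. -/
noncomputable def agentDot {Na : ℕ} (No : ℕ) (l : Fin Na → ℝ) :
    StateSpace Na No →L[ℝ] optionSpace No :=
  LinearMap.toContinuousLinearMap
    { toFun := fun Z => ∑ i, l i • Z i
      map_add' := by
        intro x y
        simp [Finset.sum_add_distrib]
      map_smul' := by
        intro c x
        simp [Finset.smul_sum, smul_comm c] }

variable {Na No : ℕ}

theorem agentDot_apply (l : Fin Na → ℝ) (Z : StateSpace Na No) :
    agentDot No l Z = ∑ i, l i • Z i := rfl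

theorem agentDot_tensorState (l v : Fin Na → ℝ) (x : optionSpace No) :
    agentDot No l (tensorState No v x) = (l ⬝ᵥ v) • x := by
  simp only [agentDot_apply, tensorState_apply, smul_smul, dotProduct, Finset.sum_smul]

theorem agentDot_agentAct {M : Matrix (Fin Na) (Fin Na) ℝ} {lam : ℝ} {l : Fin Na → ℝ}
    (hMl : M.transpose.mulVec l = lam • l) (Z : StateSpace Na No) :
    agentDot No l (agentAct No M Z) = lam • agentDot No l Z := by
  simp only [agentDot_apply, agentAct_apply, Finset.smul_sum, smul_smul]
  rw [Finset.sum_comm]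
  refine Finset.sum_congr rfl fun k _ => ?_
  rw [← Finset.sum_smul]
  congr 1
  have := congrFun hMl k
  simp only [Matrix.mulVec, dotProduct, Matrix.transpose_apply, Pi.smul_apply, smul_eq_mul] at this
  rw [← this]
  exact Finset.sum_congr rfl fun i _ => mul_comm _ _

/-- Option by option, the column `k ↦ z_{kj}` is an eigenvector, hence a multiple of `v`; since `v`
is a unit vector, pairing with `v` reads off the factor. -/
theorem IsSimpleEigenvalue.eq_tensorState {M : Matrix (Fin Na) (Fin Na) ℝ} {lam : ℝ}
    (h : IsSimpleEigenvalue M lam) {v : Fin Na → ℝ} (hvv : v ⬝ᵥ v = 1)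
    (hMv : M.mulVec v = lam • v) {Z : StateSpace Na No} (hZ : agentAct No M Z = lam • Z) :
    Z = tensorState No v (agentDot No v Z) := by
  have hv : v ≠ 0 := by
    rintro rfl
    simp at hvv
  funext i
  ext j
  have h1 : M.mulVec (fun k => (Z k).1 j) = lam • fun k => (Z k).1 j := by
    funext k
    have := congrArg (fun x : optionSpace No => x.1 j) (congrFun hZ k)
    simp only [agentAct_coe] at this
    exact this
  obtain ⟨c, hc⟩ := h.exists_eq_smul hv hMv h1
  have h2 : ∀ k, (Z k).1 j = c * v k := fun k => congrFun hc k
  have h3 : (agentDot No v Z).1 j = c := by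
    have e : (agentDot No v Z).1 j = ∑ k, v k * (Z k).1 j := by
      rw [agentDot_apply]
      simp
    rw [e]
    simp only [h2]
    calc ∑ k, v k * (c * v k) = c * ∑ k, v k * v k := by
          rw [Finset.mul_sum]
          exact Finset.sum_congr rfl fun _ _ => by ring
      _ = c := by
          have : ∑ k, v k * v k = 1 := hvv
          rw [this, mul_one]
  rw [tensorState_apply, h2]
  change c * v i = v i * (agentDot No v Z).1 j
  rw [h3, mul_comm]

/-- A state is close to the kernel component defined by the left eigenvector if `(M - λ) Z` is
small. -/
theorem IsSimpleEigenvalue.exists_norm_sub_tensorState_le {M : Matrix (Fin Na) (Fin Na) ℝ}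
    {lam : ℝ} (h : IsSimpleEigenvalue M lam) {v l : Fin Na → ℝ} (hvv : v ⬝ᵥ v = 1)
    (hMv : M.mulVec v = lam • v) (hl : l ⬝ᵥ v = 1) :
    ∃ K : ℝ, ∀ Z : StateSpace Na No,
      ‖Z - tensorState No v (agentDot No l Z)‖ ≤ K * ‖agentAct No M Z - lam • Z‖ := by
  -- The pair `((M - λ) Z, l · Z)` determines `Z`, so in finite dimension it bounds `‖Z‖`.
  -- Subtracting `v ⊗ (l · Z)` makes the second entry vanish without changing the first.
  let Λ : StateSpace Na No →L[ℝ] StateSpace Na No × optionSpace No :=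
    (agentAct No M - lam • ContinuousLinearMap.id ℝ _).prod (agentDot No l)
  have hΛ : ∀ Z, Λ Z = (agentAct No M Z - lam • Z, agentDot No l Z) := fun _ => rfl
  have hker : LinearMap.ker Λ.toLinearMap = ⊥ := by
    rw [LinearMap.ker_eq_bot']
    intro Z hZ
    have hZ : Λ Z = 0 := hZ
    rw [hΛ, Prod.mk_eq_zero, sub_eq_zero] at hZ
    have h1 := h.eq_tensorState hvv hMv hZ.1
    have h2 := hZ.2
    rw [h1, agentDot_tensorState, hl, one_smul] at h2
    rw [h1, h2, map_zero]
  obtain ⟨K, -, hK⟩ := LinearMap.exists_antilipschitzWith Λ.toLinearMap hker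
  refine ⟨K, fun Z => ?_⟩
  have h1 := hK.le_mul_dist (Z - tensorState No v (agentDot No l Z)) 0
  have h2 : Λ (Z - tensorState No v (agentDot No l Z)) = (agentAct No M Z - lam • Z, 0) := by
    rw [map_sub, hΛ, hΛ, agentAct_tensorState, agentDot_tensorState, hl, one_smul, hMv]
    have : tensorState No (lam • v) (agentDot No l Z) =
        lam • tensorState No v (agentDot No l Z) := by
      funext i
      simp [tensorState_apply, mul_smul]
    rw [this, sub_self, Prod.mk_sub_mk, sub_self, sub_zero]
  rw [dist_zero_right, map_zero, dist_zero_right] at h1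
  have h3 : Λ.toLinearMap (Z - tensorState No v (agentDot No l Z)) =
    (agentAct No M Z - lam • Z, 0) := h2
  rw [h3, Prod.norm_mk, norm_zero, max_eq_left (norm_nonneg _)] at h1
  exact h1

variable {S₁ S₂ : ℝ → ℝ} {d α β lam : ℝ} {Γ Δ : Matrix (Fin Na) (Fin Na) ℝ}

theorem homField_hasFDerivAt (hS₁ : IsSaturating S₁) (hS₂ : IsSaturating S₂)
    (h : IsAdmissible α β Γ Δ lam) (u : ℝ) :
    HasFDerivAt (homField No S₁ S₂ d α β Γ Δ u) (agentAct No (linMatrix d α β Γ Δ u)) 0 := by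
  have h0 : homField No S₁ S₂ d α β Γ Δ u 0 = 0 := by
    rw [homField_eq S₁ S₂ d α β h.diag_left h.diag_right, netResponse_zero hS₁ hS₂]
    simp
  rw [hasFDerivAt_iff_isLittleO_nhds_zero]
  simp only [zero_add, h0, sub_zero]
  refine (homField_sub_isBigO hS₁ hS₂ h u).trans_isLittleO ?_
  have : (fun Z : StateSpace Na No => ‖Z‖ ^ 2) =o[𝓝 0] fun Z => ‖Z‖ ^ 1 :=
    isLittleO_norm_pow_norm_pow one_lt_two
  exact (this.congr_right fun Z => pow_one _).of_norm_right

theorem agentAct_linMatrix_critical (h : IsAdmissible α β Γ Δ lam) (Z : StateSpace Na No) :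
    agentAct No (linMatrix d α β Γ Δ (d / (α - β + lam))) Z =
      (d / (α - β + lam)) • (agentAct No (Γ - Δ) Z - lam • Z) := by
  have h1 : d / (α - β + lam) * (α - β) - d = -(d / (α - β + lam) * lam) := by
    have := h.pos.ne'
    field_simp
    ring
  rw [linMatrix, agentAct_add, agentAct_smul, agentAct_smul, agentAct_one, h1]
  module

theorem ker_fderiv_homField (hS₁ : IsSaturating S₁) (hS₂ : IsSaturating S₂) (hd : 0 < d)
    (h : IsAdmissible α β Γ Δ lam) (hs : IsSimpleEigenvalue (Γ - Δ) lam) {v : Fin Na → ℝ}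
    (hvv : v ⬝ᵥ v = 1) (hMv : (Γ - Δ).mulVec v = lam • v) :
    LinearMap.ker (fderiv ℝ (homField No S₁ S₂ d α β Γ Δ (d / (α - β + lam))) 0).toLinearMap =
      LinearMap.range (tensorState No v) := by
  rw [(homField_hasFDerivAt hS₁ hS₂ h _).fderiv]
  have hu : d / (α - β + lam) ≠ 0 := (div_pos hd h.pos).ne'
  ext Z
  rw [LinearMap.mem_ker, LinearMap.mem_range]
  change agentAct No _ Z = 0 ↔ _
  rw [agentAct_linMatrix_critical h, smul_eq_zero_iff_right hu, sub_eq_zero]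
  constructor
  · exact fun hZ => ⟨_, (hs.eq_tensorState hvv hMv hZ).symm⟩
  · rintro ⟨x, rfl⟩
    rw [agentAct_tensorState, hMv]
    funext i
    simp [tensorState_apply, mul_smul]

section Branch

variable {E : Type*} [NormedAddCommGroup E] {f : ℝ → E → E} {u₀ : ℝ} {u : ℝ → ℝ} {Z : ℝ → E}

theorem IsBifurcationBranch.tendsto_state (h : IsBifurcationBranch f u₀ u Z) :
    Tendsto Z (𝓝[>] 0) (𝓝 0) := by
  obtain ⟨h1, -, ε, hε, hc, -⟩ := h
  have := (hc 0 (left_mem_Ico.2 hε)).tendsto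
  rw [h1] at this
  exact this.mono_left (nhdsWithin_le_of_mem (mem_of_superset (Ioo_mem_nhdsGT hε)
    Ioo_subset_Ico_self))

theorem IsBifurcationBranch.tendsto_param (h : IsBifurcationBranch f u₀ u Z) :
    Tendsto u (𝓝[>] 0) (𝓝 u₀) := by
  obtain ⟨-, h1, ε, hε, -, hc, -⟩ := h
  have := (hc 0 (left_mem_Ico.2 hε)).tendsto
  rw [h1] at this
  exact this.mono_left (nhdsWithin_le_of_mem (mem_of_superset (Ioo_mem_nhdsGT hε)
    Ioo_subset_Ico_self))

theorem IsBifurcationBranch.eventually (h : IsBifurcationBranch f u₀ u Z) :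
    ∀ᶠ s in 𝓝[>] 0, Z s ≠ 0 ∧ f (u s) (Z s) = 0 := by
  obtain ⟨-, -, ε, hε, -, -, h1⟩ := h
  filter_upwards [Ioo_mem_nhdsGT hε] with s hs using h1 s hs

end Branch

variable {u : ℝ → ℝ} {Z : ℝ → StateSpace Na No}

/-- Along a branch, `(M - λ) Z` is of higher order. -/
theorem branch_isLittleO (hS₁ : IsSaturating S₁) (hS₂ : IsSaturating S₂) (hd : 0 < d)
    (h : IsAdmissible α β Γ Δ lam)
    (hb : IsBifurcationBranch (homField No S₁ S₂ d α β Γ Δ) (d / (α - β + lam)) u Z) :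
    (fun s => agentAct No (Γ - Δ) (Z s) - lam • Z s) =o[𝓝[>] 0] Z := by
  set u₀ := d / (α - β + lam) with hu₀
  have hu₀' : u₀ ≠ 0 := (div_pos hd h.pos).ne'
  have h1 : (fun s => homField No S₁ S₂ d α β Γ Δ u₀ (Z s) -
      agentAct No (linMatrix d α β Γ Δ u₀) (Z s)) =o[𝓝[>] 0] Z := by
    have := (homField_hasFDerivAt (No := No) (d := d) hS₁ hS₂ h u₀).isLittleO
    simp only [sub_zero] at this
    have h0 : homField No S₁ S₂ d α β Γ Δ u₀ 0 = 0 := by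
      rw [homField_eq S₁ S₂ d α β h.diag_left h.diag_right, netResponse_zero hS₁ hS₂]
      simp
    simp only [h0, sub_zero] at this
    exact this.comp_tendsto hb.tendsto_state
  -- The field is affine in `u`: freezing `u` at `u₀` costs `(u - u₀)` times a term of size
  -- `O(‖Z‖)`, which is of higher order since `u → u₀`.
  have h2 : (fun s => (u s - u₀) • netResponse S₁ S₂ (α • 1 + Γ) (β • 1 + Δ) (Z s))
      =o[𝓝[>] 0] Z := by
    have hN : (fun Z : StateSpace Na No => netResponse S₁ S₂ (α • 1 + Γ) (β • 1 + Δ) Z)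
        =O[𝓝 0] fun Z => Z := by
      have := ((netResponse_contDiff (No := No) hS₁ hS₂ (α • 1 + Γ)
        (β • 1 + Δ)).differentiable (by norm_num) 0).isBigO_sub
      simpa [netResponse_zero hS₁ hS₂] using this
    have hu : (fun s => u s - u₀) =o[𝓝[>] 0] fun _ => (1 : ℝ) := by
      rw [isLittleO_one_iff]
      simpa using hb.tendsto_param.sub_const u₀
    exact (hu.smul_isBigO (hN.comp_tendsto hb.tendsto_state)).congr_right fun s => one_smul _ _
  have h3 : (fun s => u₀ • (agentAct No (Γ - Δ) (Z s) - lam • Z s)) =o[𝓝[>] 0] Z := by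
    refine (h1.add h2).neg_left.congr' ?_ EventuallyEq.rfl
    filter_upwards [hb.eventually] with s hs
    have h4 := hs.2
    rw [homField_eq S₁ S₂ d α β h.diag_left h.diag_right] at h4 ⊢
    rw [← agentAct_linMatrix_critical h, ← hu₀]
    set N := netResponse S₁ S₂ (α • 1 + Γ) (β • 1 + Δ) (Z s)
    have h5 : -(d • Z s) = -(u s • N) := eq_neg_of_add_eq_zero_left h4
    rw [h5]
    module
  exact (isLittleO_const_smul_left hu₀').1 h3

theorem branch_sub_tensorState_isLittleO (hS₁ : IsSaturating S₁) (hS₂ : IsSaturating S₂)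
    (hd : 0 < d) (h : IsAdmissible α β Γ Δ lam) (hs : IsSimpleEigenvalue (Γ - Δ) lam)
    {v l : Fin Na → ℝ} (hvv : v ⬝ᵥ v = 1) (hMv : (Γ - Δ).mulVec v = lam • v) (hl : l ⬝ᵥ v = 1)
    (hb : IsBifurcationBranch (homField No S₁ S₂ d α β Γ Δ) (d / (α - β + lam)) u Z) :
    (fun s => Z s - tensorState No v (agentDot No l (Z s))) =o[𝓝[>] 0] Z := by
  obtain ⟨K, hK⟩ := hs.exists_norm_sub_tensorState_le (No := No) hvv hMv hl
  refine IsBigO.trans_isLittleO ?_ (branch_isLittleO hS₁ hS₂ hd h hb)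
  exact IsBigO.of_bound K (Eventually.of_forall fun s => hK (Z s))

theorem IsSimpleEigenvalue.exists_left_eigenvector {M : Matrix (Fin Na) (Fin Na) ℝ}
    (hs : IsSimpleEigenvalue M lam) {v : Fin Na → ℝ} (hvv : v ⬝ᵥ v = 1)
    (hMv : M.mulVec v = lam • v) :
    ∃ l : Fin Na → ℝ, l ⬝ᵥ v = 1 ∧ M.transpose.mulVec l = lam • l := by
  have hv : v ≠ 0 := by
    rintro rfl
    simp at hvv
  obtain ⟨l, hl, hMl⟩ := exists_mulVec_eq_smul hs.transpose.isRoot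
  have := hs.dotProduct_ne_zero hv hMv hl hMl
  refine ⟨(l ⬝ᵥ v)⁻¹ • l, ?_, ?_⟩
  · rw [smul_dotProduct, smul_eq_mul, inv_mul_cancel₀ this]
  · rw [Matrix.mulVec_smul, hMl, smul_comm]

theorem branch_isTangentTo_range (hS₁ : IsSaturating S₁) (hS₂ : IsSaturating S₂)
    (hd : 0 < d) (h : IsAdmissible α β Γ Δ lam) (hs : IsSimpleEigenvalue (Γ - Δ) lam)
    {v : Fin Na → ℝ} (hvv : v ⬝ᵥ v = 1) (hMv : (Γ - Δ).mulVec v = lam • v)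
    (hb : IsBifurcationBranch (homField No S₁ S₂ d α β Γ Δ) (d / (α - β + lam)) u Z) :
    IsTangentTo Z (LinearMap.range (tensorState No v)) := by
  obtain ⟨l, hl, -⟩ := hs.exists_left_eigenvector hvv hMv
  exact ⟨_, fun s => LinearMap.mem_range_self _ _,
    branch_sub_tensorState_isLittleO hS₁ hS₂ hd h hs hvv hMv hl hb⟩

end Kernel

/-! ### Branches in axial directions -/

section DividedResponse

/-- `S(t) = t q(t)` with `q` of class `C¹`. -/
theorem IsSaturating.exists_eq_mul {S : ℝ → ℝ} (hS : IsSaturating S) :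
    ∃ q : ℝ → ℝ, ContDiff ℝ 1 q ∧ q 0 = 1 ∧ ∀ t, S t = t * q t := by
  set a := iteratedDeriv 2 S 0 with ha
  -- The derivative of `S(t) / t` off zero, extended by the value `S''(0) / 2` given by the Taylor
  -- expansion. Continuity of this extension at 0 then yields differentiability of the quotient
  -- there.
  let g : ℝ → ℝ := fun t => if t = 0 then a / 2 else (t * deriv S t - S t) / t ^ 2
  have hS1 : Differentiable ℝ S := hS.contDiff.differentiable (by norm_num)
  have hdS : ContDiff ℝ 2 (deriv S) := ((contDiff_succ_iff_deriv (n := 2)).1 hS.contDiff).2.2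
  have hq : ∀ t, S t = t * dslope S 0 t := by
    intro t
    have := sub_smul_dslope S 0 t
    rw [hS.map_zero, sub_zero, sub_zero, smul_eq_mul] at this
    exact this.symm
  have hqne : ∀ t, t ≠ 0 → HasDerivAt (dslope S 0) (g t) t := by
    intro t ht
    have h1 : HasDerivAt (fun t => S t / t) ((deriv S t * t - S t * 1) / t ^ 2) t :=
      (hS1 t).hasDerivAt.fun_div (hasDerivAt_id t) ht
    have h2 : g t = (deriv S t * t - S t * 1) / t ^ 2 := by
      simp only [g, if_neg ht]
      ring
    rw [h2]
    refine h1.congr_of_eventuallyEq ?_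
    filter_upwards [isOpen_ne.mem_nhds ht] with z hz
    rw [hq z, mul_div_cancel_left₀ _ hz]
  have hg0 : ContinuousAt g 0 := by
    rw [continuousAt_iff_punctured_nhds]
    have h1 : (fun t => deriv S t - 1 - a * t) =o[𝓝 0] fun t => t := by
      have h2 : HasDerivAt (deriv S) a 0 := by
        have e : a = deriv (deriv S) 0 := by
          rw [ha, iteratedDeriv_succ, iteratedDeriv_one]
        rw [e]
        exact (hdS.differentiable (by norm_num) 0).hasDerivAt
      have := h2.isLittleO
      simp only [sub_zero, hS.deriv_zero, smul_eq_mul] at this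
      exact this.congr_left fun t => by ring
    have h2 : (fun t => t * deriv S t - S t - a / 2 * t ^ 2) =o[𝓝 0] fun t => t ^ 2 := by
      have h3 : (fun t : ℝ => t * (deriv S t - 1 - a * t)) =o[𝓝 0] fun t => t ^ 2 :=
        ((isBigO_refl (fun t : ℝ => t) (𝓝 0)).mul_isLittleO h1).congr_right fun t => (sq t).symm
      exact (h3.sub hS.isLittleO_two).congr_left fun t => by
        rw [← ha]
        ring
    have h3 := (h2.mono nhdsWithin_le_nhds).tendsto_div_nhds_zero (l := 𝓝[≠] (0 : ℝ))
    have h4 : g 0 = a / 2 := if_pos rfl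
    rw [h4, ← zero_add (a / 2)]
    refine (h3.add_const (a / 2)).congr' ?_
    filter_upwards [self_mem_nhdsWithin] with t ht
    have ht : t ≠ 0 := ht
    simp only [g, if_neg ht]
    field_simp
    ring
  have hgne : ∀ t, t ≠ 0 → ContinuousAt g t := by
    intro t ht
    have h1 : ContinuousAt (fun t => (t * deriv S t - S t) / t ^ 2) t := by
      refine ContinuousAt.div ?_ (by fun_prop) (pow_ne_zero 2 ht)
      exact ((continuous_id.mul hdS.continuous).sub hS.continuous).continuousAt
    refine h1.congr ?_
    filter_upwards [isOpen_ne.mem_nhds ht] with z hz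
    simp only [g, if_neg hz]
  have hqc : ContinuousAt (dslope S 0) 0 := continuousAt_dslope_same.2 (hS1 0)
  have hderiv : ∀ t, HasDerivAt (dslope S 0) (g t) t :=
    hasDerivAt_of_hasDerivAt_of_ne' hqne hqc hg0
  refine ⟨dslope S 0, ?_, ?_, hq⟩
  · rw [contDiff_one_iff_deriv]
    refine ⟨fun t => (hderiv t).differentiableAt, ?_⟩
    rw [show deriv (dslope S 0) = g from funext fun t => (hderiv t).deriv]
    exact continuous_iff_continuousAt.2 fun t => by
      rcases eq_or_ne t 0 with rfl | ht
      · exact hg0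
      · exact hgne t ht
  · rw [dslope_same, hS.deriv_zero]

end DividedResponse

section Implicit

/-- A root branch from the implicit function theorem in finite dimension. -/
theorem exists_root_branch {F : Type*} [NormedAddCommGroup F] [NormedSpace ℝ F]
    [FiniteDimensional ℝ F] {G : ℝ × F → F} (hG : ContDiff ℝ 1 G) (hG0 : G 0 = 0)
    {D : F → F} (hD : ∀ w, HasDerivAt (fun t : ℝ => G (0, t • w)) (D w) 0)
    (hinj : ∀ w, D w = 0 → w = 0) :
    ∃ w : ℝ → F, w 0 = 0 ∧ ContDiffAt ℝ 1 w 0 ∧ ∀ᶠ s in 𝓝 0, G (s, w s) = 0 := by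
  have : CompleteSpace F := FiniteDimensional.complete ℝ F
  -- The directional derivatives `D` determine the partial derivative in `F`, and an injective
  -- endomorphism of a finite-dimensional space is invertible.
  set T : F →L[ℝ] F := fderiv ℝ G 0 ∘L .inr ℝ ℝ F with hT
  have hTD : ∀ w, T w = D w := by
    intro w
    have h1 : HasDerivAt (fun t : ℝ => ((0 : ℝ), t • w)) (0, w) 0 := by
      refine (hasDerivAt_const _ _).prodMk ?_
      simpa using (hasDerivAt_id (0 : ℝ)).smul_const w
    have h2 : HasFDerivAt G (fderiv ℝ G 0) ((0 : ℝ), (0 : ℝ) • w) := by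
      rw [zero_smul]
      exact (hG.differentiable one_ne_zero 0).hasFDerivAt
    exact (h2.comp_hasDerivAt (0 : ℝ) h1).unique (hD w)
  have hTinj : Function.Injective T.toLinearMap := by
    rw [← LinearMap.ker_eq_bot, LinearMap.ker_eq_bot']
    exact fun w hw => hinj w ((hTD w).symm.trans hw)
  have hinv : T.IsInvertible :=
    ⟨(LinearEquiv.ofInjectiveEndo T.toLinearMap hTinj).toContinuousLinearEquiv, by
      ext w
      rfl⟩
  have hGa : ContDiffAt ℝ 1 G ((0 : ℝ), (0 : F)) := hG.contDiffAt
  refine ⟨hGa.implicitFunction one_ne_zero hinv, ?_, ?_, ?_⟩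
  · exact hGa.implicitFunction_apply_self one_ne_zero hinv
  · exact hGa.contDiffAt_implicitFunction one_ne_zero hinv
  · filter_upwards [hGa.eventually_apply_implicitFunction one_ne_zero hinv] with s hs
    rw [hs]
    exact hG0

end Implicit

/-! ### Reduction to the invariant subspace of an axial vector -/

section Axial

variable {Na No : ℕ}

theorem IsAxialVector.ne_zero {x : optionSpace No} (hx : IsAxialVector x) : x ≠ 0 := by
  obtain ⟨H, ⟨-, h1⟩, h2⟩ := hx
  rintro rfl
  rw [h2, Submodule.span_zero_singleton, finrank_bot] at h1
  exact zero_ne_one h1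

/-- Functions of an axial vector project to multiples of it. -/
theorem IsAxialVector.optionProjL_comp_mem {x : optionSpace No} (hx : IsAxialVector x)
    (φ : ℝ → ℝ) : optionProjL No (fun j => φ (x.1 j)) ∈ Submodule.span ℝ {x} := by
  obtain ⟨H, -, h2⟩ := hx
  have hxH : x ∈ optionFixed H := by
    rw [h2]
    exact Submodule.mem_span_singleton_self x
  rw [← h2]
  intro σ hσ j
  rw [optionProjL_coe, optionProjL_coe, hxH σ hσ j]

theorem exists_functional {x : optionSpace No} (hx : x ≠ 0) :
    ∃ pr : optionSpace No →L[ℝ] ℝ, pr x = 1 ∧ ∀ y ∈ Submodule.span ℝ {x}, y = pr y • x := by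
  obtain ⟨g, hg⟩ := SeparatingDual.exists_eq_one (R := ℝ) hx
  refine ⟨g, hg, fun y hy => ?_⟩
  obtain ⟨c, rfl⟩ := Submodule.mem_span_singleton.1 hy
  rw [map_smul, hg, smul_eq_mul, mul_one]

theorem tensorState_smul_left (c : ℝ) (v : Fin Na → ℝ) (x : optionSpace No) :
    tensorState No (c • v) x = c • tensorState No v x := by
  funext i
  simp [tensorState_apply, mul_smul]

variable {S₁ S₂ : ℝ → ℝ} {d α β lam : ℝ} {Γ Δ : Matrix (Fin Na) (Fin Na) ℝ}

/-- Perturbation of `v` normalized by the functional `l`. -/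
noncomputable def normalizedPerturb (v l w : Fin Na → ℝ) : Fin Na → ℝ :=
  v + (w - (l ⬝ᵥ w) • v)

/-- The equilibrium equation in the direction `x`, divided by the amplitude. -/
noncomputable def reducedField (A B : Matrix (Fin Na) (Fin Na) ℝ) (q₁ q₂ : ℝ → ℝ) (d u₀ : ℝ)
    (pr : optionSpace No →L[ℝ] ℝ) (x : optionSpace No) (v l : Fin Na → ℝ)
    (p : ℝ × (Fin Na → ℝ)) : Fin Na → ℝ :=
  fun i => -(d * normalizedPerturb v l p.2 i) + (u₀ + l ⬝ᵥ p.2) * pr (optionProjL No fun j =>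
    A.mulVec (normalizedPerturb v l p.2) i * x.1 j *
        q₁ (p.1 * (A.mulVec (normalizedPerturb v l p.2) i * x.1 j)) -
      B.mulVec (normalizedPerturb v l p.2) i * x.1 j *
        q₂ (p.1 * (B.mulVec (normalizedPerturb v l p.2) i * x.1 j)))

theorem reducedField_contDiff (A B : Matrix (Fin Na) (Fin Na) ℝ) {q₁ q₂ : ℝ → ℝ}
    (hq₁ : ContDiff ℝ 1 q₁) (hq₂ : ContDiff ℝ 1 q₂) (d u₀ : ℝ)
    (pr : optionSpace No →L[ℝ] ℝ) (x : optionSpace No) (v l : Fin Na → ℝ) :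
    ContDiff ℝ 1 (reducedField A B q₁ q₂ d u₀ pr x v l) := by
  have hdot : ContDiff ℝ 1 fun p : ℝ × (Fin Na → ℝ) => l ⬝ᵥ p.2 := by
    simp only [dotProduct]
    fun_prop
  have hy : ∀ i, ContDiff ℝ 1 fun p : ℝ × (Fin Na → ℝ) => normalizedPerturb v l p.2 i := by
    intro i
    simp only [normalizedPerturb, Pi.add_apply, Pi.sub_apply, Pi.smul_apply, smul_eq_mul]
    fun_prop
  have hA : ∀ (A : Matrix (Fin Na) (Fin Na) ℝ) i, ContDiff ℝ 1 fun p : ℝ × (Fin Na → ℝ) =>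
      A.mulVec (normalizedPerturb v l p.2) i := by
    intro A i
    simp only [Matrix.mulVec, dotProduct]
    fun_prop
  rw [contDiff_pi]
  intro i
  have hA1 := hA A i
  have hB1 := hA B i
  have hyi := hy i
  refine ContDiff.add (by fun_prop) (ContDiff.mul (by fun_prop) ?_)
  refine pr.contDiff.comp ((optionProjL No).contDiff.comp (contDiff_pi.2 fun j => ?_))
  fun_prop

theorem netResponse_tensorState {x : optionSpace No} (hx : IsAxialVector x)
    {pr : optionSpace No →L[ℝ] ℝ} (hpr : ∀ y ∈ Submodule.span ℝ {x}, y = pr y • x)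
    {q₁ q₂ : ℝ → ℝ} (hq₁ : ∀ t, S₁ t = t * q₁ t) (hq₂ : ∀ t, S₂ t = t * q₂ t)
    (A B : Matrix (Fin Na) (Fin Na) ℝ) (s : ℝ) (y : Fin Na → ℝ) (i : Fin Na) :
    netResponse S₁ S₂ A B (tensorState No (s • y) x) i =
      (s * pr (optionProjL No fun j => A.mulVec y i * x.1 j * q₁ (s * (A.mulVec y i * x.1 j)) -
        B.mulVec y i * x.1 j * q₂ (s * (B.mulVec y i * x.1 j)))) • x := by
  set φ : ℝ → ℝ := fun t => A.mulVec y i * t * q₁ (s * (A.mulVec y i * t)) -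
        B.mulVec y i * t * q₂ (s * (B.mulVec y i * t)) with hφ
  have h1 := hpr _ (hx.optionProjL_comp_mem φ)
  have hc : ∀ (A : Matrix (Fin Na) (Fin Na) ℝ) j,
      (agentAct No A (tensorState No (s • y) x) i).1 j = s * (A.mulVec y i * x.1 j) := by
    intro A j
    rw [agentAct_tensorState, Matrix.mulVec_smul, tensorState_apply]
    simp [mul_assoc]
  have h2 : netResponse S₁ S₂ A B (tensorState No (s • y) x) i =
      s • optionProjL No (fun j => φ (x.1 j)) := by
    simp only [netResponse, response, Pi.sub_apply]
    rw [← map_sub, ← map_smul]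
    congr 1
    funext j
    simp only [Pi.sub_apply, Pi.smul_apply, smul_eq_mul, hc, hq₁, hq₂, hφ]
    ring
  rw [h2, mul_smul]
  exact congrArg (s • ·) h1

/-- A single unknown `w` carries both corrections: its part in the kernel of `l` perturbs the agent
vector, while `l · w`, which normalization removes from that vector, shifts the parameter `u`. There
are thus as many unknowns as equations. -/
theorem homField_tensorState (h : IsAdmissible α β Γ Δ lam) {x : optionSpace No}
    (hx : IsAxialVector x) {pr : optionSpace No →L[ℝ] ℝ}
    (hpr : ∀ y ∈ Submodule.span ℝ {x}, y = pr y • x)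
    {q₁ q₂ : ℝ → ℝ} (hq₁ : ∀ t, S₁ t = t * q₁ t) (hq₂ : ∀ t, S₂ t = t * q₂ t)
    (u₀ : ℝ) (v l : Fin Na → ℝ) (p : ℝ × (Fin Na → ℝ)) :
    homField No S₁ S₂ d α β Γ Δ (u₀ + l ⬝ᵥ p.2)
        (tensorState No (p.1 • normalizedPerturb v l p.2) x) =
      tensorState No (p.1 • reducedField (α • 1 + Γ) (β • 1 + Δ) q₁ q₂ d u₀ pr x v l p) x := by
  rw [homField_eq S₁ S₂ d α β h.diag_left h.diag_right]
  funext i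
  rw [Pi.add_apply, Pi.smul_apply, netResponse_tensorState hx hpr hq₁ hq₂]
  simp only [Pi.neg_apply, Pi.smul_apply, tensorState_apply, reducedField, smul_eq_mul]
  module

/-- The divided equation is solved for `w` as a function of the amplitude `s`. Since `w(0) = 0`, the
slope `Z(s) / s` tends to `v ⊗ x`; since the perturbed agent vector keeps pairing 1 with `l`, the
branch is nonzero for `s > 0`. -/
theorem exists_axial_branch (hS₁ : IsSaturating S₁) (hS₂ : IsSaturating S₂) (hd : 0 < d)
    (h : IsAdmissible α β Γ Δ lam) (hs : IsSimpleEigenvalue (Γ - Δ) lam) {v : Fin Na → ℝ}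
    (hvv : v ⬝ᵥ v = 1) (hMv : (Γ - Δ).mulVec v = lam • v) {x : optionSpace No}
    (hx : IsAxialVector x) :
    ∃ (u : ℝ → ℝ) (Z : ℝ → StateSpace Na No),
      IsBifurcationBranch (homField No S₁ S₂ d α β Γ Δ) (d / (α - β + lam)) u Z ∧
      HasDerivWithinAt Z (tensorState No v x) (Ici 0) 0 := by
  obtain ⟨l, hl, hMl⟩ := hs.exists_left_eigenvector hvv hMv
  obtain ⟨q₁, hq₁c, hq₁0, hq₁⟩ := hS₁.exists_eq_mul
  obtain ⟨q₂, hq₂c, hq₂0, hq₂⟩ := hS₂.exists_eq_mul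
  obtain ⟨pr, hprx, hpr⟩ := exists_functional hx.ne_zero
  have hv : v ≠ 0 := by
    rintro rfl
    simp at hvv
  set κ := α - β + lam with hκ
  have hκ0 : 0 < κ := h.pos
  set u₀ := d / κ with hu₀
  have hu₀0 : 0 < u₀ := div_pos hd hκ0
  have hu₀κ : u₀ * κ = d := div_mul_cancel₀ _ hκ0.ne'
  set N : Matrix (Fin Na) (Fin Na) ℝ := (α • 1 + Γ) - (β • 1 + Δ) with hN
  have hNy : ∀ y, N.mulVec y = (α - β) • y + (Γ - Δ).mulVec y := by
    intro y
    have : N = (α - β) • 1 + (Γ - Δ) := by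
      rw [hN]
      module
    rw [this, Matrix.add_mulVec, Matrix.smul_mulVec, Matrix.one_mulVec]
  have hNv : N.mulVec v = κ • v := by
    rw [hNy, hMv, hκ]
    module
  have hlN : ∀ y, l ⬝ᵥ N.mulVec y = κ * (l ⬝ᵥ y) := by
    intro y
    rw [hNy, dotProduct_add, dotProduct_smul, dotProduct_mulVec_of_left_eigenvector hMl, hκ,
      smul_eq_mul]
    ring
  set G := reducedField (α • 1 + Γ) (β • 1 + Δ) q₁ q₂ d u₀ pr x v l with hG
  have hGc : ContDiff ℝ 1 G := reducedField_contDiff _ _ hq₁c hq₂c _ _ _ _ _ _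
  have hG0 : ∀ w, G (0, w) = -(d • normalizedPerturb v l w) +
      (u₀ + l ⬝ᵥ w) • N.mulVec (normalizedPerturb v l w) := by
    intro w
    funext i
    have e : (fun j => Matrix.mulVec (α • 1 + Γ) (normalizedPerturb v l w) i * x.1 j * 1 -
        Matrix.mulVec (β • 1 + Δ) (normalizedPerturb v l w) i * x.1 j * 1) =
        (N.mulVec (normalizedPerturb v l w) i) • x.1 := by
      funext j
      rw [hN, Matrix.sub_mulVec]
      simp only [Pi.sub_apply, Pi.smul_apply, smul_eq_mul]
      ring
    simp only [hG, reducedField, zero_mul, hq₁0, hq₂0]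
    rw [e, map_smul, optionProjL_of_mem, map_smul, hprx]
    simp
  let Pw : (Fin Na → ℝ) → (Fin Na → ℝ) := fun w => w - (l ⬝ᵥ w) • v
  have hlP : ∀ w, l ⬝ᵥ Pw w = 0 := by
    intro w
    simp only [Pw, dotProduct_sub, dotProduct_smul, hl, smul_eq_mul, mul_one, sub_self]
  have hnp : ∀ w, normalizedPerturb v l w = v + Pw w := fun _ => rfl
  -- As `d = u₀ κ`, this is `u₀ (M - λ) Pw + κ (l · w) v` with `M = Γ - Δ` and `Pw` the projection
  -- of `w` to the kernel of `l`. Pairing with `l` isolates `κ (l · w)`, so a zero of `D` is an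
  -- eigenvector for `λ` (or zero) with `l · w = 0`, and simplicity forces `w = 0`.
  let D : (Fin Na → ℝ) → (Fin Na → ℝ) := fun w =>
    -(d • Pw w) + u₀ • N.mulVec (Pw w) + ((l ⬝ᵥ w) * κ) • v
  have hPt : ∀ (t : ℝ) w, Pw (t • w) = t • Pw w := by
    intro t w
    simp only [Pw, dotProduct_smul, smul_eq_mul]
    module
  have hD : ∀ w, HasDerivAt (fun t : ℝ => G (0, t • w)) (D w) 0 := by
    intro w
    have e : (fun t : ℝ => G (0, t • w)) =
        fun t : ℝ => t • D w + t ^ 2 • ((l ⬝ᵥ w) • N.mulVec (Pw w)) := by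
      funext t
      rw [hG0, hnp, hPt, Matrix.mulVec_add, hNv, Matrix.mulVec_smul, dotProduct_smul, smul_eq_mul]
      simp only [D]
      rw [← hu₀κ]
      module
    rw [e]
    have h1 : HasDerivAt (fun t : ℝ => t • D w) ((1 : ℝ) • D w) 0 :=
      (hasDerivAt_id (0 : ℝ)).smul_const (D w)
    have h2 := ((hasDerivAt_id (0 : ℝ)).fun_pow 2).smul_const ((l ⬝ᵥ w) • N.mulVec (Pw w))
    have h3 := h1.fun_add h2
    simpa using h3
  have hinj : ∀ w, D w = 0 → w = 0 := by
    intro w hw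
    have h1 : l ⬝ᵥ D w = (l ⬝ᵥ w) * κ := by
      simp only [D, dotProduct_add, dotProduct_neg, dotProduct_smul, hlN, hlP, hl, smul_eq_mul]
      ring
    rw [hw, dotProduct_zero] at h1
    have h2 : l ⬝ᵥ w = 0 := (mul_eq_zero.1 h1.symm).resolve_right hκ0.ne'
    have h3 : Pw w = w := by simp [Pw, h2]
    simp only [D, h2, h3, zero_mul, zero_smul, add_zero] at hw
    rw [hNy, ← hu₀κ] at hw
    have h4 : u₀ • ((Γ - Δ).mulVec w - lam • w) = 0 := by
      rw [← hw, hκ]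
      module
    have h5 := sub_eq_zero.1 ((smul_eq_zero.1 h4).resolve_left hu₀0.ne')
    obtain ⟨c, rfl⟩ := hs.exists_eq_smul hv hMv h5
    rw [dotProduct_smul, hl, smul_eq_mul, mul_one] at h2
    rw [h2, zero_smul]
  have hG00 : G 0 = 0 := by
    have := hG0 0
    rw [hnp] at this
    have hP0 : Pw 0 = 0 := by simp [Pw]
    rw [hP0, add_zero, hNv, dotProduct_zero, add_zero, smul_smul, hu₀κ, neg_add_cancel] at this
    exact this
  obtain ⟨w, hw0, hwc, hwG⟩ := exists_root_branch hGc hG00 hD hinj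
  have hcont : ∀ᶠ s in 𝓝 (0 : ℝ), ContinuousAt w s := by
    filter_upwards [hwc.eventually (by simp)] with s hs using hs.continuousAt
  obtain ⟨ε, hε, hball⟩ := Metric.eventually_nhds_iff_ball.1 (hcont.and hwG)
  have hIco : ∀ s ∈ Ico 0 ε, s ∈ Metric.ball (0 : ℝ) ε := by
    intro s hs
    rw [mem_ball_zero_iff, Real.norm_eq_abs, abs_of_nonneg hs.1]
    exact hs.2
  have hdotc : Continuous fun y : Fin Na → ℝ => l ⬝ᵥ y := by
    simp only [dotProduct]
    fun_prop
  have hnpc : Continuous fun y : Fin Na → ℝ => tensorState No (normalizedPerturb v l y) x := by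
    simp only [normalizedPerturb]
    refine continuous_pi fun i => ?_
    simp only [tensorState_apply, Pi.add_apply, Pi.sub_apply, Pi.smul_apply, smul_eq_mul]
    fun_prop
  have hwon : ContinuousOn w (Ico 0 ε) := fun s hs =>
    (hball s (hIco s hs)).1.continuousWithinAt
  refine ⟨fun s => u₀ + l ⬝ᵥ w s, fun s => tensorState No (s • normalizedPerturb v l (w s)) x,
    ⟨?_, ?_, ε, hε, ?_, ?_, ?_⟩, ?_⟩
  · exact (tensorState_smul_left 0 _ x).trans (zero_smul ℝ _)
  · simp [hw0]
  · simp only [tensorState_smul_left]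
    exact continuousOn_id.smul (hnpc.comp_continuousOn hwon)
  · exact continuousOn_const.add (hdotc.comp_continuousOn hwon)
  · intro s hs'
    have hsb := hball s (hIco s (Ioo_subset_Ico_self hs'))
    constructor
    · intro h0
      refine hx.ne_zero (tensorState_eq_zero (smul_ne_zero hs'.1.ne' ?_) h0)
      intro h1
      have h2 : l ⬝ᵥ normalizedPerturb v l (w s) = 1 := by
        rw [hnp, dotProduct_add, hlP, hl, add_zero]
      rw [h1, dotProduct_zero] at h2
      exact zero_ne_one h2
    · have := homField_tensorState (S₁ := S₁) (S₂ := S₂) (d := d) h hx hpr hq₁ hq₂ u₀ v l (s, w s)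
      refine this.trans ?_
      rw [← hG, hsb.2, smul_zero]
      funext i
      simp [tensorState_apply]
  · simp only [tensorState_smul_left]
    have h1 : Tendsto (fun s => tensorState No (normalizedPerturb v l (w s)) x) (𝓝[>] 0)
        (𝓝 (tensorState No v x)) := by
      have h2 := (hnpc.tendsto (w 0)).comp hwc.continuousAt
      rw [hw0] at h2
      have h3 : normalizedPerturb v l 0 = v := by simp [normalizedPerturb]
      rw [h3] at h2
      exact h2.mono_left nhdsWithin_le_nhds
    rw [← hasDerivWithinAt_Ioi_iff_Ici, hasDerivWithinAt_iff_tendsto_slope' self_notMem_Ioi]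
    refine h1.congr' ?_
    filter_upwards [self_mem_nhdsWithin] with s hs
    have hs : 0 < s := hs
    rw [slope_def_module]
    simp only [zero_smul, sub_zero, smul_smul]
    rw [inv_mul_cancel₀ hs.ne', one_smul]

end Axial

/-! ### Axial vectors and the quadratic equivariant -/

section TwoValued

variable {No : ℕ}

theorem isAxialVector_of_fixed_eq_span {x : optionSpace No} (hx : x ≠ 0)
    (h : optionFixed (optionIsotropy x) = Submodule.span ℝ {x}) : IsAxialVector x :=
  ⟨optionIsotropy x, ⟨⟨x, rfl⟩, by rw [h, finrank_span_singleton hx]⟩, h⟩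

theorem exists_coe_ne {x : optionSpace No} (hx : x ≠ 0) : ∃ j, x.1 j ≠ 0 := by
  by_contra! hall
  exact hx (Subtype.ext (funext hall))

theorem eq_or_eq_of_sq_eq {x : optionSpace No} {τ q : ℝ} (h : ∀ j, x.1 j ^ 2 = τ * x.1 j + q)
    {j₀ k₀ : Fin No} (hk₀ : x.1 k₀ ≠ x.1 j₀) (j : Fin No) : x.1 j = x.1 j₀ ∨ x.1 j = x.1 k₀ := by
  rcases eq_or_ne (x.1 j) (x.1 j₀) with hj | hj
  · exact Or.inl hj
  refine Or.inr ?_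
  have e1 : (x.1 j - x.1 j₀) * (x.1 j + x.1 j₀ - τ) = 0 := by
    linear_combination h j - h j₀
  have e2 : (x.1 k₀ - x.1 j₀) * (x.1 k₀ + x.1 j₀ - τ) = 0 := by
    linear_combination h k₀ - h j₀
  have f1 := (mul_eq_zero.1 e1).resolve_left (sub_ne_zero.2 hj)
  have f2 := (mul_eq_zero.1 e2).resolve_left (sub_ne_zero.2 hk₀)
  linarith

/-- If the entries of `x ≠ 0` are roots of one quadratic polynomial, every vector that is constant
on the level sets of `x` is a multiple of `x`. -/
theorem mem_span_of_sq_eq {x : optionSpace No} (hx : x ≠ 0) {τ q : ℝ}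
    (h : ∀ j, x.1 j ^ 2 = τ * x.1 j + q) {y : optionSpace No}
    (hconst : ∀ j k, x.1 j = x.1 k → y.1 j = y.1 k) : ∃ c : ℝ, c • x = y := by
  obtain ⟨j₀, hj₀⟩ := exists_coe_ne hx
  have hN : (No : ℝ) ≠ 0 := by
    have := j₀.pos
    positivity
  obtain ⟨k₀, hk₀⟩ : ∃ k, x.1 k ≠ x.1 j₀ := by
    by_contra! hall
    have h1 := optionSpace_sum x
    simp only [hall, Finset.sum_const, Finset.card_univ, Fintype.card_fin, nsmul_eq_mul] at h1
    exact hj₀ ((mul_eq_zero.1 h1).resolve_left hN)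
  have hne : x.1 k₀ - x.1 j₀ ≠ 0 := sub_ne_zero.2 hk₀
  -- As `x` takes only two values, any function of them is affine in `x`. Both vectors have zero
  -- sum, so the constant term vanishes.
  set c := (y.1 k₀ - y.1 j₀) / (x.1 k₀ - x.1 j₀) with hc
  have hck : c * (x.1 k₀ - x.1 j₀) = y.1 k₀ - y.1 j₀ := div_mul_cancel₀ _ hne
  have haff : ∀ j, y.1 j = c * x.1 j + (y.1 j₀ - c * x.1 j₀) := by
    intro j
    rcases eq_or_eq_of_sq_eq h hk₀ j with hj | hj
    · rw [hconst j j₀ hj, hj]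
      ring
    · rw [hconst j k₀ hj, hj]
      linarith
  have hsum := optionSpace_sum y
  rw [Finset.sum_congr rfl fun j _ => haff j, Finset.sum_add_distrib, ← Finset.mul_sum,
    optionSpace_sum, mul_zero, zero_add] at hsum
  simp only [Finset.sum_const, Finset.card_univ, Fintype.card_fin, nsmul_eq_mul] at hsum
  have h0 := (mul_eq_zero.1 hsum).resolve_left hN
  refine ⟨c, ?_⟩
  ext j
  rw [haff j, h0, add_zero]
  rfl

/-- A nonzero vector all of whose entries are roots of one quadratic polynomial is axial. -/
theorem isAxialVector_of_sq_eq {x : optionSpace No} (hx : x ≠ 0) {τ q : ℝ}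
    (h : ∀ j, x.1 j ^ 2 = τ * x.1 j + q) : IsAxialVector x := by
  refine isAxialVector_of_fixed_eq_span hx (le_antisymm (fun y hy => ?_) ?_)
  · refine Submodule.mem_span_singleton.2 (mem_span_of_sq_eq hx h fun j k hjk => ?_)
    -- Swapping two options with equal entries fixes `x`, so it must fix `y`.
    have := hy (Equiv.swap j k) (fun i => ?_) k
    · rwa [Equiv.swap_apply_right] at this
    · rcases eq_or_ne i j with rfl | hij
      · rw [Equiv.swap_apply_left, hjk]
      · rcases eq_or_ne i k with rfl | hik
        · rw [Equiv.swap_apply_right, hjk]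
        · rw [Equiv.swap_apply_of_ne_of_ne hij hik]
  · rw [Submodule.span_singleton_le_iff_mem]
    exact fun σ hσ j => hσ j

theorem exists_coe_pos {x : optionSpace No} (hx : x ≠ 0) : ∃ j, 0 < x.1 j := by
  by_contra! hall
  obtain ⟨j, hj⟩ := exists_coe_ne hx
  exact hj ((Finset.sum_eq_zero_iff_of_nonpos fun k _ => hall k).1 (optionSpace_sum x) j
    (Finset.mem_univ j))

theorem exists_coe_neg {x : optionSpace No} (hx : x ≠ 0) : ∃ j, x.1 j < 0 := by
  obtain ⟨j, hj⟩ := exists_coe_pos (neg_ne_zero.2 hx)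
  exact ⟨j, neg_pos.1 hj⟩

/-- The entries take at most two values, and zero sum forces both signs to occur; hence the sign of
an entry determines its value. -/
theorem coe_eq_of_pos_iff {x : optionSpace No} (hx : x ≠ 0) {τ q : ℝ}
    (h : ∀ j, x.1 j ^ 2 = τ * x.1 j + q) {j k : Fin No} (hjk : 0 < x.1 j ↔ 0 < x.1 k) :
    x.1 j = x.1 k := by
  by_contra hne
  obtain ⟨m, hm⟩ := exists_coe_pos hx
  obtain ⟨n, hn⟩ := exists_coe_neg hx
  rcases lt_or_ge 0 (x.1 j) with hj | hj
  · have hk := hjk.1 hj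
    rcases eq_or_eq_of_sq_eq h (Ne.symm hne) n with e | e <;> linarith
  · have hk := not_lt.1 fun hk => hj.not_gt (hjk.2 hk)
    rcases eq_or_eq_of_sq_eq h (Ne.symm hne) m with e | e <;> linarith

theorem peakVector_isAxialVector (hNo : 2 ≤ No) (j₀ : Fin No) : IsAxialVector (peakVector j₀) := by
  -- The entries are `1 - 1/No` and `-1/No`; `τ` is their sum and `-q` their product.
  refine isAxialVector_of_sq_eq (peakVector_ne_zero hNo j₀) (τ := 1 - 2 / No)
    (q := 1 / No - 1 / No ^ 2) fun j => ?_
  have hN : (No : ℝ) ≠ 0 := by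
    have := j₀.pos
    positivity
  rw [peakVector_coe]
  split_ifs <;> field_simp <;> ring

/-- The cross terms that vanish exactly when `projSq x` is parallel to `x`. -/
noncomputable def projSqCross (x : optionSpace No) (j k : Fin No) : ℝ :=
  (projSq x).1 j * x.1 k - (projSq x).1 k * x.1 j

theorem projSq_coe (x : optionSpace No) (j : Fin No) :
    (projSq x).1 j = x.1 j ^ 2 - 1 / (No : ℝ) * ∑ l, x.1 l ^ 2 := rfl

/-- Vanishing cross terms mean `projSq x = τ x`, which reads `x_j² = τ x_j + q` with `q` the mean of
the squares. -/
theorem exists_sq_eq_of_projSqCross_eq_zero {x : optionSpace No} (hx : x ≠ 0)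
    (h : ∀ j k, projSqCross x j k = 0) : ∃ τ q : ℝ, ∀ j, x.1 j ^ 2 = τ * x.1 j + q := by
  obtain ⟨k, hk⟩ := exists_coe_ne hx
  refine ⟨(projSq x).1 k / x.1 k, 1 / (No : ℝ) * ∑ l, x.1 l ^ 2, fun j => ?_⟩
  have h1 := h j k
  rw [projSqCross, sub_eq_zero] at h1
  have h2 : (projSq x).1 j = (projSq x).1 k / x.1 k * x.1 j := by
    rw [div_mul_eq_mul_div, eq_div_iff hk, h1]
  have h3 := projSq_coe x j
  linarith

/-- Such a vector is determined up to a positive factor by the set of options where it is positive,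
and the norm fixes the factor. There are finitely many subsets. -/
theorem finite_projSqCross_eq_zero :
    {x : optionSpace No | ‖x‖ = 1 ∧ ∀ j k, projSqCross x j k = 0}.Finite := by
  refine Set.Finite.of_finite_image (f := fun x => {j | 0 < x.1 j}) (Set.toFinite _) ?_
  rintro x ⟨hx1, hxc⟩ y ⟨hy1, hyc⟩ hxy
  have hpos : ∀ j, 0 < x.1 j ↔ 0 < y.1 j := fun j => Set.ext_iff.1 hxy j
  have hx : x ≠ 0 := norm_ne_zero_iff.1 (by rw [hx1]; exact one_ne_zero)
  have hy : y ≠ 0 := norm_ne_zero_iff.1 (by rw [hy1]; exact one_ne_zero)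
  obtain ⟨τ, q, h⟩ := exists_sq_eq_of_projSqCross_eq_zero hx hxc
  obtain ⟨τ', q', h'⟩ := exists_sq_eq_of_projSqCross_eq_zero hy hyc
  obtain ⟨c, rfl⟩ := mem_span_of_sq_eq hx h (y := y) fun j k hjk =>
    coe_eq_of_pos_iff hy h' (by rw [← hpos, ← hpos, hjk])
  obtain ⟨j, hj⟩ := exists_coe_pos hx
  have hcj : 0 < c * x.1 j := (hpos j).1 hj
  have hc : 0 < c := pos_of_mul_pos_left hcj hj.le
  rw [norm_smul, hx1, mul_one, Real.norm_eq_abs, abs_of_pos hc] at hy1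
  rw [hy1, one_smul]

theorem continuous_projSqCross (j k : Fin No) :
    Continuous fun x : optionSpace No => projSqCross x j k := by
  have hc : ∀ j, Continuous fun x : optionSpace No => x.1 j := fun j =>
    (continuous_apply j).comp continuous_subtype_val
  simp only [projSqCross, projSq_coe]
  have hs : Continuous fun x : optionSpace No => ∑ l, x.1 l ^ 2 :=
    continuous_finsetSum _ fun l _ => (hc l).pow 2
  exact ((((hc j).pow 2).sub (continuous_const.mul hs)).mul (hc k)).sub
    ((((hc k).pow 2).sub (continuous_const.mul hs)).mul (hc j))

theorem projSq_smul (c : ℝ) (x : optionSpace No) : projSq (c • x) = c ^ 2 • projSq x := by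
  rw [projSq, projSq, ← map_smul]
  congr 1
  funext j
  exact mul_pow c (x.1 j) 2

theorem projSqCross_smul (c : ℝ) (x : optionSpace No) (j k : Fin No) :
    projSqCross (c • x) j k = c ^ 3 * projSqCross x j k := by
  simp only [projSqCross, projSq_smul]
  simp only [Submodule.coe_smul, Pi.smul_apply, smul_eq_mul]
  ring

end TwoValued

/-! ### Convergence of curves with finitely many cluster points -/

section Limit

/-- A curve in a compact set whose cluster points at the left end lie in a finite set converges. -/
theorem exists_tendsto_of_finite_clusterPts {X : Type*} [MetricSpace X] {g : ℝ → X} {K A : Set X}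
    (hK : IsCompact K) {ε : ℝ} (hε : 0 < ε) (hg : ContinuousOn g (Ioo 0 ε))
    (hgK : ∀ s ∈ Ioo 0 ε, g s ∈ K) (hA : A.Finite)
    (hcl : ∀ x, MapClusterPt x (𝓝[>] 0) g → x ∈ A) : ∃ a ∈ A, Tendsto g (𝓝[>] 0) (𝓝 a) := by
  have hev : ∀ᶠ s in 𝓝[>] (0 : ℝ), s ∈ Ioo 0 ε := Ioo_mem_nhdsGT hε
  obtain ⟨a, -, ha⟩ := hK.exists_mapClusterPt_of_frequently (hev.mono hgK).frequently
  refine ⟨a, hcl a ha, ?_⟩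
  obtain ⟨r, hr, hrA⟩ : ∃ r > 0, ∀ x ∈ A, dist x a < r → x = a := by
    have h1 : ∀ᶠ x in 𝓝 a, x ∉ A \ {a} :=
      (hA.subset sdiff_subset).isClosed.isOpen_compl.mem_nhds fun h => h.2 rfl
    obtain ⟨r, hr, h2⟩ := Metric.eventually_nhds_iff.1 h1
    refine ⟨r, hr, fun x hx hxa => ?_⟩
    by_contra hne
    exact h2 hxa ⟨hx, hne⟩
  -- The sphere of radius `ρ < r` about `a` contains no cluster point, so by compactness the curve
  -- eventually avoids it. The curve returns to the ball arbitrarily late, and by the intermediate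
  -- value theorem it cannot leave it again.
  have hsmall : ∀ ρ, 0 < ρ → ρ < r → ∀ᶠ s in 𝓝[>] (0 : ℝ), dist (g s) a < ρ := by
    intro ρ hρ hρr
    have hne : ∀ᶠ s in 𝓝[>] (0 : ℝ), dist (g s) a ≠ ρ := by
      by_contra hcon
      have hfr : ∃ᶠ s in 𝓝[>] (0 : ℝ), dist (g s) a = ρ := by
        rw [Filter.Frequently]
        exact hcon
      obtain ⟨x, hx, hxc⟩ := (hK.inter_right (Metric.isClosed_sphere (x := a) (ε := ρ)))
        |>.exists_mapClusterPt_of_frequently ((hfr.and_eventually hev).mono fun s hs =>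
          ⟨hgK s hs.2, hs.1⟩)
      have hxρ : dist x a = ρ := hx.2
      have := hrA x (hcl x hxc) (by rw [hxρ]; exact hρr)
      rw [this, dist_self] at hxρ
      exact hρ.ne hxρ
    obtain ⟨δ, hδ, hδne⟩ := (mem_nhdsGT_iff_exists_Ioo_subset).1 (hne.and hev)
    have hδ : (0 : ℝ) < δ := hδ
    have hfreq : ∃ᶠ s in 𝓝[>] (0 : ℝ), dist (g s) a < ρ :=
      ha.frequently (Metric.ball_mem_nhds a hρ)
    obtain ⟨s₀, hs₀, hs₀δ⟩ := (hfreq.and_eventually (Ioo_mem_nhdsGT hδ)).exists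
    filter_upwards [Ioo_mem_nhdsGT hδ] with s hs
    by_contra hcon
    have hpc : IsPreconnected (Ioo 0 δ) := isPreconnected_Ioo
    have hcont : ContinuousOn (fun s => dist (g s) a) (Ioo 0 δ) :=
      (continuous_id.dist continuous_const).comp_continuousOn (hg.mono fun t ht => (hδne ht).2)
    obtain ⟨t, ht, hteq⟩ := hpc.intermediate_value hs₀δ hs hcont ⟨hs₀.le, not_lt.1 hcon⟩
    exact (hδne ht).1 hteq
  rw [Metric.tendsto_nhds]
  intro ρ hρ
  filter_upwards [hsmall (min ρ (r / 2)) (by positivity)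
    ((min_le_right _ _).trans_lt (by linarith))] with s hs
  exact hs.trans_le (min_le_left _ _)

end Limit

/-! ### Branches with nondegenerate quadratic term -/

section Quadratic

variable {Na No : ℕ}

/-- The coefficient of the quadratic equivariant in the reduced equation. -/
noncomputable def quadCoeff (a₁ a₂ : ℝ) (A B : Matrix (Fin Na) (Fin Na) ℝ) (v l : Fin Na → ℝ) :
    ℝ :=
  ∑ i, l i * (a₁ * A.mulVec v i ^ 2 - a₂ * B.mulVec v i ^ 2)

theorem agentDot_quadResponse_tensorState (a₁ a₂ : ℝ) (A B : Matrix (Fin Na) (Fin Na) ℝ)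
    (v l : Fin Na → ℝ) (x : optionSpace No) :
    agentDot No l (a₁ • quadResponse A (tensorState No v x) -
      a₂ • quadResponse B (tensorState No v x)) = quadCoeff a₁ a₂ A B v l • projSq x := by
  have h : ∀ (A : Matrix (Fin Na) (Fin Na) ℝ) i, quadResponse A (tensorState No v x) i =
      A.mulVec v i ^ 2 • projSq x := by
    intro A i
    rw [quadResponse, agentAct_tensorState, tensorState_apply, projSq_smul]
  simp only [agentDot_apply, Pi.sub_apply, Pi.smul_apply, h, quadCoeff, Finset.sum_smul]
  refine Finset.sum_congr rfl fun i _ => ?_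
  module

/-- Coordinatewise, a difference of squares is an `o(‖Z‖)` difference times an `O(‖Z‖)` sum. This
allows replacing `Z` by its kernel component in the quadratic term. -/
theorem quadResponse_sub_isLittleO (A : Matrix (Fin Na) (Fin Na) ℝ) {Z Y : ℝ → StateSpace Na No}
    {F : Filter ℝ} (h : (fun s => Z s - Y s) =o[F] Z) :
    (fun s => quadResponse A (Z s) - quadResponse A (Y s)) =o[F] fun s => ‖Z s‖ ^ 2 := by
  have hY : Y =O[F] Z := by
    have := (isBigO_refl Z F).sub h.isBigO
    exact this.congr_left fun s => by simp
  rw [isLittleO_pi]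
  intro i
  have hcoord : ∀ j, (fun s => (agentAct No A (Z s) i).1 j ^ 2 - (agentAct No A (Y s) i).1 j ^ 2)
      =o[F] fun s => ‖Z s‖ ^ 2 := by
    intro j
    have hL : ∀ X : ℝ → StateSpace Na No,
        (fun s => (agentAct No A (X s) i).1 j) =O[F] X := fun X =>
      ((stateCoord i j).comp (agentAct No A)).isBigO_comp X F
    have h1 : (fun s => (agentAct No A (Z s) i).1 j - (agentAct No A (Y s) i).1 j) =o[F]
        fun s => ‖Z s‖ := by
      refine (((hL fun s => Z s - Y s).trans_isLittleO h).norm_right).congr_left fun s => ?_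
      rw [map_sub]
      rfl
    have h2 : (fun s => (agentAct No A (Z s) i).1 j + (agentAct No A (Y s) i).1 j) =O[F]
        fun s => ‖Z s‖ := ((hL Z).add ((hL Y).trans hY)).norm_right
    refine ((h1.mul_isBigO h2).congr_left fun s => ?_).congr_right fun s => (sq _).symm
    ring
  have h3 : (fun s => (fun j => (agentAct No A (Z s) i).1 j ^ 2) -
      fun j => (agentAct No A (Y s) i).1 j ^ 2) =o[F] fun s => ‖Z s‖ ^ 2 :=
    isLittleO_pi.2 hcoord
  refine (((optionProjL No).isBigO_comp _ F).trans_isLittleO h3).congr_left fun s => ?_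
  rw [map_sub]
  rfl

variable {S₁ S₂ : ℝ → ℝ} {d α β lam : ℝ} {Γ Δ : Matrix (Fin Na) (Fin Na) ℝ}
  {u : ℝ → ℝ} {Z : ℝ → StateSpace Na No} {v l : Fin Na → ℝ}

/-- The bifurcation equation along a branch, up to second order. -/
theorem branch_reduced_isLittleO (hS₁ : IsSaturating S₁) (hS₂ : IsSaturating S₂)
    (hd : 0 < d) (h : IsAdmissible α β Γ Δ lam) (hs : IsSimpleEigenvalue (Γ - Δ) lam)
    (hvv : v ⬝ᵥ v = 1) (hMv : (Γ - Δ).mulVec v = lam • v) (hl : l ⬝ᵥ v = 1)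
    (hMl : (Γ - Δ).transpose.mulVec l = lam • l)
    (hb : IsBifurcationBranch (homField No S₁ S₂ d α β Γ Δ) (d / (α - β + lam)) u Z) :
    (fun s => (u s * (α - β + lam) - d) • agentDot No l (Z s) +
      (u s * quadCoeff (iteratedDeriv 2 S₁ 0 / 2) (iteratedDeriv 2 S₂ 0 / 2)
        (α • 1 + Γ) (β • 1 + Δ) v l) • projSq (agentDot No l (Z s))) =o[𝓝[>] 0]
      fun s => ‖Z s‖ ^ 2 := by
  set A : Matrix (Fin Na) (Fin Na) ℝ := α • 1 + Γ with hA
  set B : Matrix (Fin Na) (Fin Na) ℝ := β • 1 + Δ with hB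
  set a₁ := iteratedDeriv 2 S₁ 0 / 2
  set a₂ := iteratedDeriv 2 S₂ 0 / 2
  have h0 := branch_sub_tensorState_isLittleO hS₁ hS₂ hd h hs hvv hMv hl hb
  set Y : ℝ → StateSpace Na No := fun s => tensorState No v (agentDot No l (Z s)) with hY
  have h1 := (netResponse_isLittleO (No := No) hS₁ hS₂ A B).comp_tendsto hb.tendsto_state
  have h2 := ((quadResponse_sub_isLittleO A h0).const_smul_left a₁).sub
    ((quadResponse_sub_isLittleO B h0).const_smul_left a₂)
  have h3 := ((agentDot No l).isBigO_comp _ _).trans_isLittleO (h1.add h2)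
  have hu : u =O[𝓝[>] 0] fun _ => (1 : ℝ) := hb.tendsto_param.isBigO_one ℝ
  have h4 := ((hu.smul_isLittleO h3).neg_left).congr_right fun s => one_smul ℝ _
  refine h4.congr' ?_ EventuallyEq.rfl
  filter_upwards [hb.eventually] with s hs'
  have h5 := hs'.2
  rw [homField_eq S₁ S₂ d α β h.diag_left h.diag_right, ← hA, ← hB] at h5
  have h6 : -(d • agentDot No l (Z s)) + u s • agentDot No l (netResponse S₁ S₂ A B (Z s)) = 0 := by
    rw [← map_smul, ← map_smul, ← map_neg, ← map_add, h5, map_zero]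
  -- The left eigenvector reduces the linear part to the scalar `α - β + λ` exactly, with no error
  -- from the component outside the kernel.
  have h7 : agentDot No l (agentAct No (A - B) (Z s)) =
      (α - β + lam) • agentDot No l (Z s) := by
    have e : A - B = (α - β) • 1 + (Γ - Δ) := by
      rw [hA, hB]
      module
    rw [e, agentAct_add, agentAct_smul, agentAct_one, map_add, agentDot_agentAct hMl, map_smul]
    module
  have h8 := agentDot_quadResponse_tensorState a₁ a₂ A B v l (agentDot No l (Z s))
  rw [map_sub, map_smul, map_smul] at h8
  simp only [Function.comp, Pi.smul_apply, map_add, map_sub, map_smul, h7]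
  have h9 : d • agentDot No l (Z s) = u s • agentDot No l (netResponse S₁ S₂ A B (Z s)) := by
    rw [← sub_eq_zero, ← neg_eq_zero, ← h6]
    abel
  have h10 : (u s * (α - β + lam) - d) • agentDot No l (Z s) =
      (u s * (α - β + lam)) • agentDot No l (Z s) - d • agentDot No l (Z s) := by module
  have h11 : (u s * quadCoeff a₁ a₂ A B v l) • projSq (agentDot No l (Z s)) =
      u s • (quadCoeff a₁ a₂ A B v l • projSq (agentDot No l (Z s))) := mul_smul _ _ _
  rw [h10, h9, h11, ← h8]
  change -(u s • (_ - _ - (a₁ • _ - a₂ • _) + _)) = _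
  module

/-- If the quadratic coefficient does not vanish, every branch is tangent to an axial direction. -/
theorem branch_isTangentTo_axial (hS₁ : IsSaturating S₁) (hS₂ : IsSaturating S₂)
    (hd : 0 < d) (h : IsAdmissible α β Γ Δ lam) (hs : IsSimpleEigenvalue (Γ - Δ) lam)
    (hvv : v ⬝ᵥ v = 1) (hMv : (Γ - Δ).mulVec v = lam • v) (hl : l ⬝ᵥ v = 1)
    (hMl : (Γ - Δ).transpose.mulVec l = lam • l)
    (hc : quadCoeff (iteratedDeriv 2 S₁ 0 / 2) (iteratedDeriv 2 S₂ 0 / 2)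
        (α • 1 + Γ) (β • 1 + Δ) v l ≠ 0)
    (hb : IsBifurcationBranch (homField No S₁ S₂ d α β Γ Δ) (d / (α - β + lam)) u Z) :
    ∃ x : optionSpace No, IsAxialVector x ∧
      IsTangentTo Z (Submodule.span ℝ {tensorState No v x}) := by
  have h0 := branch_sub_tensorState_isLittleO hS₁ hS₂ hd h hs hvv hMv hl hb
  have h1 := branch_reduced_isLittleO hS₁ hS₂ hd h hs hvv hMv hl hMl hb
  set c₂ := quadCoeff (iteratedDeriv 2 S₁ 0 / 2) (iteratedDeriv 2 S₂ 0 / 2)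
        (α • 1 + Γ) (β • 1 + Δ) v l
  set ξ : ℝ → optionSpace No := fun s => agentDot No l (Z s) with hξ
  have hξZ : ξ =O[𝓝[>] 0] Z := (agentDot No l).isBigO_comp Z _
  let τ : optionSpace No →L[ℝ] StateSpace Na No := LinearMap.toContinuousLinearMap (tensorState No v)
  have hτ : ∀ x, τ x = tensorState No v x := fun _ => rfl
  -- The part of `Z` outside the kernel is `o(‖Z‖)`, so `Z` and `ξ` have comparable size and errors
  -- may be measured in either.
  have hZξ : Z =O[𝓝[>] 0] ξ := by
    have h2 := h0.right_isBigO_sub.congr_right fun s => sub_sub_cancel _ _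
    exact h2.trans (τ.isBigO_comp ξ _)
  have hξ0 : ∀ᶠ s in 𝓝[>] 0, ξ s ≠ 0 := by
    obtain ⟨C, hC⟩ := hZξ.bound
    filter_upwards [hC, hb.eventually] with s hs1 hs2 hs3
    rw [hs3, norm_zero, mul_zero] at hs1
    exact hs2.1 (norm_le_zero_iff.1 hs1)
  -- Antisymmetrizing the reduced equation against `ξ` cancels the linear term, however `u` behaves.
  -- Division by `u c₂`, which has a nonzero limit, leaves the cross terms of `projSq ξ`.
  have hcross : ∀ j k, (fun s => projSqCross (ξ s) j k) =o[𝓝[>] 0] fun s => ‖ξ s‖ ^ 3 := by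
    intro j k
    set e : ℝ → optionSpace No := fun s => (u s * (α - β + lam) - d) • ξ s +
      (u s * c₂) • projSq (ξ s) with he
    have hcoord : ∀ (X : ℝ → optionSpace No) j, (fun s => (X s).1 j) =O[𝓝[>] 0] X := fun X j =>
      IsBigO.of_bound 1 (Eventually.of_forall fun s => by
        rw [one_mul]
        exact abs_coe_le_norm (X s) j)
    have he2 : e =o[𝓝[>] 0] fun s => ‖ξ s‖ ^ 2 := h1.trans_isBigO (hZξ.norm_norm.pow 2)
    have hprod : ∀ j k, (fun s => (e s).1 j * (ξ s).1 k) =o[𝓝[>] 0] fun s => ‖ξ s‖ ^ 3 :=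
      fun j k => (((hcoord e j).trans_isLittleO he2).mul_isBigO
        (hcoord ξ k).norm_right).congr_right fun s => by ring
    have hlim : Tendsto (fun s => u s * c₂) (𝓝[>] 0) (𝓝 (d / (α - β + lam) * c₂)) :=
      hb.tendsto_param.mul_const c₂
    have hne : d / (α - β + lam) * c₂ ≠ 0 := mul_ne_zero (div_pos hd h.pos).ne' hc
    have hinv : (fun s => (u s * c₂)⁻¹) =O[𝓝[>] 0] fun _ => (1 : ℝ) :=
      (hlim.inv₀ hne).isBigO_one ℝ
    refine ((hinv.mul_isLittleO ((hprod j k).sub (hprod k j))).congr_right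
      fun s => one_mul _).congr' ?_ EventuallyEq.rfl
    filter_upwards [hlim.eventually_ne hne] with s hs1
    have h3 : (e s).1 j * (ξ s).1 k - (e s).1 k * (ξ s).1 j =
        u s * c₂ * projSqCross (ξ s) j k := by
      simp only [he, projSqCross, Submodule.coe_add, Submodule.coe_smul, Pi.add_apply,
        Pi.smul_apply, smul_eq_mul]
      ring
    rw [h3, inv_mul_cancel_left₀ hs1]
  set g : ℝ → optionSpace No := fun s => ‖ξ s‖⁻¹ • ξ s with hg
  have hgcross : ∀ j k, Tendsto (fun s => projSqCross (g s) j k) (𝓝[>] 0) (𝓝 0) := by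
    intro j k
    refine (hcross j k).tendsto_div_nhds_zero.congr fun s => ?_
    rw [hg, projSqCross_smul, inv_pow, div_eq_inv_mul]
  obtain ⟨-, -, ε, hε, hZc, -, -⟩ := hb
  obtain ⟨δ, hδ, hδsub⟩ := mem_nhdsGT_iff_exists_Ioo_subset.1 (hξ0.and (Ioo_mem_nhdsGT hε))
  have hδ : (0 : ℝ) < δ := hδ
  have hξc : ContinuousOn ξ (Ioo 0 δ) := (agentDot No l).continuous.comp_continuousOn
    (hZc.mono fun s hs1 => Ioo_subset_Ico_self (hδsub hs1).2)
  have hgc : ContinuousOn g (Ioo 0 δ) :=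
    (hξc.norm.inv₀ fun s hs1 => norm_ne_zero_iff.2 (hδsub hs1).1).smul hξc
  have hgK : ∀ s ∈ Ioo 0 δ, g s ∈ Metric.sphere (0 : optionSpace No) 1 := by
    intro s hs1
    rw [mem_sphere_zero_iff_norm, hg, norm_smul, norm_inv, norm_norm]
    exact inv_mul_cancel₀ (norm_ne_zero_iff.2 (hδsub hs1).1)
  obtain ⟨a, ⟨ha1, hac⟩, hga⟩ := exists_tendsto_of_finite_clusterPts (isCompact_sphere _ _) hδ hgc hgK
    finite_projSqCross_eq_zero fun x hx => by
      constructor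
      · have : x ∈ Metric.sphere (0 : optionSpace No) 1 := by
          refine Metric.isClosed_sphere.mem_of_mapClusterPt hx ?_
          filter_upwards [Ioo_mem_nhdsGT hδ] with s hs1 using hgK s hs1
        exact mem_sphere_zero_iff_norm.1 this
      · intro j k
        have h2 := hx.tendsto_comp (continuous_projSqCross j k).continuousAt
        have h3 : MapClusterPt (projSqCross x j k) (𝓝[>] 0) fun s => projSqCross (g s) j k := h2
        exact eq_of_nhds_neBot (h3.clusterPt.mono (hgcross j k))
  have ha0 : a ≠ 0 := norm_ne_zero_iff.1 (by rw [ha1]; exact one_ne_zero)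
  obtain ⟨t, q, htq⟩ := exists_sq_eq_of_projSqCross_eq_zero ha0 hac
  refine ⟨a, isAxialVector_of_sq_eq ha0 htq, fun s => ‖ξ s‖ • tensorState No v a,
    fun s => Submodule.smul_mem _ _ (Submodule.mem_span_singleton_self _), ?_⟩
  have h2 : (fun s => ξ s - ‖ξ s‖ • a) =o[𝓝[>] 0] ξ := by
    have h3 : (fun s => g s - a) =o[𝓝[>] 0] fun _ => (1 : ℝ) := by
      rw [isLittleO_one_iff]
      simpa using hga.sub_const a
    have h4 := ((isBigO_refl (fun s => ‖ξ s‖) (𝓝[>] 0)).smul_isLittleO h3).congr_right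
      fun s => (smul_eq_mul _ _).trans (mul_one _)
    refine (h4.of_norm_right).congr' ?_ EventuallyEq.rfl
    filter_upwards [hξ0] with s hs1
    rw [hg, smul_sub, smul_smul, mul_inv_cancel₀ (norm_ne_zero_iff.2 hs1), one_smul]
  refine (h0.add (((τ.isBigO_comp _ _).trans_isLittleO h2).trans_isBigO hξZ)).congr_left
    fun s => ?_
  rw [map_sub, map_smul, hτ, hτ]
  abel

end Quadratic

/-! ### Genericity of the quadratic coefficient -/

section Generic

/-- A simple real eigenvalue persists under small perturbations. -/
theorem IsSimpleEigenvalue.eventually_exists_isRoot {n : ℕ} {M : Matrix (Fin n) (Fin n) ℝ}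
    {lam : ℝ} (h : IsSimpleEigenvalue M lam) {ε : ℝ} (hε : 0 < ε) :
    ∀ᶠ N in 𝓝 M, ∃ r, lam - ε ≤ r ∧ N.charpoly.IsRoot r := by
  have hne := (Matrix.charpoly_monic M).ne_zero
  obtain ⟨q, hq, hqd⟩ := Polynomial.exists_eq_pow_rootMultiplicity_mul_and_not_dvd
    M.charpoly hne lam
  have hmult : M.charpoly.rootMultiplicity lam = 1 := h
  rw [hmult, pow_one] at hq
  have hq0 : q.eval lam ≠ 0 := fun h0 => hqd (Polynomial.dvd_iff_isRoot.2 h0)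
  have hsq : ∀ᶠ t in 𝓝 (0 : ℝ), 0 < q.eval (lam - t) * q.eval (lam + t) := by
    have hc : Continuous fun t : ℝ => q.eval (lam - t) * q.eval (lam + t) := by fun_prop
    refine hc.tendsto 0 |>.eventually (lt_mem_nhds ?_)
    rw [sub_zero, add_zero]
    exact mul_self_pos.2 hq0
  obtain ⟨t, ht1, ht2, ht3⟩ : ∃ t, 0 < q.eval (lam - t) * q.eval (lam + t) ∧ 0 < t ∧ t ≤ ε := by
    obtain ⟨t, h1, h2⟩ := ((hsq.filter_mono nhdsWithin_le_nhds).and (Ioc_mem_nhdsGT hε)).exists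
    exact ⟨t, h1, h2.1, h2.2⟩
  -- At a simple root the characteristic polynomial changes sign. The sign change at fixed points
  -- `lam ± t` survives small perturbations of the matrix and encloses a real root.
  have hneg : M.charpoly.eval (lam - t) * M.charpoly.eval (lam + t) < 0 := by
    rw [hq]
    simp only [Polynomial.eval_mul, Polynomial.eval_sub, Polynomial.eval_X, Polynomial.eval_C]
    have : 0 < t ^ 2 * (q.eval (lam - t) * q.eval (lam + t)) := by positivity
    nlinarith
  have hcont : ∀ x : ℝ, Continuous fun N : Matrix (Fin n) (Fin n) ℝ => N.charpoly.eval x := by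
    intro x
    simp only [Matrix.eval_charpoly]
    fun_prop
  filter_upwards [((hcont (lam - t)).mul (hcont (lam + t))).tendsto M |>.eventually
    (gt_mem_nhds hneg)] with N hN
  have hN : N.charpoly.eval (lam - t) * N.charpoly.eval (lam + t) < 0 := hN
  have hIVT := intermediate_value_uIcc (a := lam - t) (b := lam + t)
    (f := fun x => N.charpoly.eval x) N.charpoly.continuous.continuousOn
  have h0 : (0 : ℝ) ∈ uIcc (N.charpoly.eval (lam - t)) (N.charpoly.eval (lam + t)) := by
    rw [mem_uIcc]
    rcases mul_neg_iff.1 hN with h1 | h1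
    · exact Or.inr ⟨h1.2.le, h1.1.le⟩
    · exact Or.inl ⟨h1.1.le, h1.2.le⟩
  obtain ⟨r, hr, hr0⟩ := hIVT h0
  rw [uIcc_of_le (by linarith)] at hr
  exact ⟨r, by linarith [hr.1], hr0⟩

theorem IsLeadingEigenvalue.le_of_isRoot {n : ℕ} {M : Matrix (Fin n) (Fin n) ℝ} {lam r : ℝ}
    (h : IsLeadingEigenvalue M lam) (hr : M.charpoly.IsRoot r) : r ≤ lam := by
  have e : (M.map Complex.ofReal).charpoly = M.charpoly.map Complex.ofRealHom :=
    Matrix.charpoly_map M Complex.ofRealHom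
  have h1 : (r : ℂ) ∈ spectrum ℂ (M.map Complex.ofReal) := by
    rw [Matrix.mem_spectrum_iff_isRoot_charpoly, e]
    exact hr.map (f := Complex.ofRealHom)
  exact h.re_le _ h1

theorem isRoot_of_mulVec_eq_smul {n : ℕ} {M : Matrix (Fin n) (Fin n) ℝ} {lam : ℝ}
    {v : Fin n → ℝ} (hv : v ≠ 0) (hMv : M.mulVec v = lam • v) : M.charpoly.IsRoot lam := by
  have h1 : Module.End.HasEigenvalue (Matrix.toLin' M) lam :=
    Module.End.hasEigenvalue_of_hasEigenvector (x := v)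
      ⟨Module.End.mem_eigenspace_iff.2 (by rw [Matrix.toLin'_apply, hMv]), hv⟩
  have h2 := (Module.End.hasEigenvalue_iff_isRoot_charpoly _ _).1 h1
  rwa [Matrix.charpoly_toLin'] at h2

theorem IsLeadingEigenvalue.unique {n : ℕ} {M : Matrix (Fin n) (Fin n) ℝ} {lam lam' : ℝ}
    (h : IsLeadingEigenvalue M lam) (h' : IsLeadingEigenvalue M lam') : lam = lam' :=
  le_antisymm (h'.re_le _ h.mem) (h.re_le _ h'.mem)

theorem isCompact_dotProduct_self_eq_one (n : ℕ) : IsCompact {v : Fin n → ℝ | v ⬝ᵥ v = 1} := by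
  refine Metric.isCompact_of_isClosed_isBounded ?_ ?_
  · refine isClosed_eq ?_ continuous_const
    simp only [dotProduct]
    fun_prop
  · refine (Metric.isBounded_closedBall (x := 0) (r := 1)).subset fun v hv => ?_
    rw [mem_closedBall_zero_iff, pi_norm_le_iff_of_nonneg zero_le_one]
    intro i
    have hv : ∑ j, v j * v j = 1 := hv
    have h1 := Finset.single_le_sum (f := fun j => v j * v j) (fun j _ => mul_self_nonneg (v j))
      (Finset.mem_univ i)
    rw [Real.norm_eq_abs, ← sq_le_one_iff_abs_le_one, sq]
    linarith

theorem quadCoeff_smul {Na : ℕ} (a₁ a₂ : ℝ) (A B : Matrix (Fin Na) (Fin Na) ℝ)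
    (v l : Fin Na → ℝ) (c c' : ℝ) :
    quadCoeff a₁ a₂ A B (c • v) (c' • l) = c' * c ^ 2 * quadCoeff a₁ a₂ A B v l := by
  simp only [quadCoeff, Matrix.mulVec_smul, Pi.smul_apply, smul_eq_mul, Finset.mul_sum]
  exact Finset.sum_congr rfl fun i _ => by ring

/-- The parameters `(α, β, Γ, Δ)`. -/
abbrev Params (Na : ℕ) : Type :=
  ℝ × ℝ × Matrix (Fin Na) (Fin Na) ℝ × Matrix (Fin Na) (Fin Na) ℝ

/-- The vanishing of the quadratic coefficient for unit left and right leading eigenvectors. -/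
def degenerateParams (Na : ℕ) (a₁ a₂ : ℝ) : Set (Params Na) :=
  {p | ∃ lam v w, IsAdmissible p.1 p.2.1 p.2.2.1 p.2.2.2 lam ∧
    v ⬝ᵥ v = 1 ∧ w ⬝ᵥ w = 1 ∧ (p.2.2.1 - p.2.2.2).mulVec v = lam • v ∧
    (p.2.2.1 - p.2.2.2).transpose.mulVec w = lam • w ∧
    quadCoeff a₁ a₂ (p.1 • 1 + p.2.2.1) (p.2.1 • 1 + p.2.2.2) v w = 0}

variable {Na : ℕ} {a₁ a₂ : ℝ}

/-- Unit eigenvectors of degenerate parameters near `p` have limits by compactness, and every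
defining equation passes to the limit. What needs proof is that the limiting eigenvalue is still the
leading one; persistence of the simple root supplies this. -/
theorem mem_degenerateParams_of_mem_closure {p : Params Na} (hp : p ∈ simpleParams Na)
    (hcl : p ∈ closure (degenerateParams Na a₁ a₂)) : p ∈ degenerateParams Na a₁ a₂ := by
  obtain ⟨lam, hadm, hsimple⟩ := hp
  obtain ⟨U, hU, hUp⟩ := mem_closure_iff_ultrafilter.1 hcl
  have hex : ∀ q : Params Na, ∃ (r : ℝ) (v w : Fin Na → ℝ), q ∈ degenerateParams Na a₁ a₂ →
      IsAdmissible q.1 q.2.1 q.2.2.1 q.2.2.2 r ∧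
      v ⬝ᵥ v = 1 ∧ w ⬝ᵥ w = 1 ∧ (q.2.2.1 - q.2.2.2).mulVec v = r • v ∧
      (q.2.2.1 - q.2.2.2).transpose.mulVec w = r • w ∧
      quadCoeff a₁ a₂ (q.1 • 1 + q.2.2.1) (q.2.1 • 1 + q.2.2.2) v w = 0 := by
    intro q
    by_cases hq : q ∈ degenerateParams Na a₁ a₂
    · obtain ⟨r, v, w, h⟩ := hq
      exact ⟨r, v, w, fun _ => h⟩
    · exact ⟨0, 0, 0, fun h => absurd h hq⟩
  choose r v w hrvw using hex
  have hev : ∀ᶠ q in (U : Filter (Params Na)), q ∈ degenerateParams Na a₁ a₂ := hU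
  have hcomp := isCompact_dotProduct_self_eq_one Na
  obtain ⟨v₀, hv₀, hv⟩ := hcomp.ultrafilter_le_nhds (U.map v) (by
    rw [Ultrafilter.coe_map, le_principal_iff, mem_map]
    filter_upwards [hev] with q hq using (hrvw q hq).2.1)
  obtain ⟨w₀, hw₀, hw⟩ := hcomp.ultrafilter_le_nhds (U.map w) (by
    rw [Ultrafilter.coe_map, le_principal_iff, mem_map]
    filter_upwards [hev] with q hq using (hrvw q hq).2.2.1)
  have hv : Tendsto v U (𝓝 v₀) := hv
  have hw : Tendsto w U (𝓝 w₀) := hw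
  have hid : Tendsto (fun q : Params Na => q) U (𝓝 p) := hUp
  have hcM : Continuous fun q : Params Na => q.2.2.1 - q.2.2.2 := by fun_prop
  have htriple : Tendsto (fun q => (q, v q, w q)) U (𝓝 (p, v₀, w₀)) :=
    hid.prodMk_nhds (hv.prodMk_nhds hw)
  have hlim : ∀ {X : Type} [TopologicalSpace X]
      (F : Params Na × (Fin Na → ℝ) × (Fin Na → ℝ) → X), Continuous F →
      Tendsto (fun q => F (q, v q, w q)) U (𝓝 (F (p, v₀, w₀))) := fun F hF =>
    (hF.tendsto _).comp htriple
  let M : Params Na → Matrix (Fin Na) (Fin Na) ℝ := fun q => q.2.2.1 - q.2.2.2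
  -- For a unit eigenvector the eigenvalue is `v · M v`, a continuous expression, so the eigenvalues
  -- converge along with the vectors.
  let R : Params Na × (Fin Na → ℝ) × (Fin Na → ℝ) → ℝ := fun x => x.2.1 ⬝ᵥ (M x.1).mulVec x.2.1
  have hRc : Continuous R := by
    simp only [R, M]
    fun_prop
  have hRr : ∀ q ∈ degenerateParams Na a₁ a₂, R (q, v q, w q) = r q := by
    intro q hq
    obtain ⟨-, h2, -, h4, -, -⟩ := hrvw q hq
    simp only [R, M]
    rw [h4, dotProduct_smul, h2, smul_eq_mul, mul_one]
  set r₀ := R (p, v₀, w₀) with hr₀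
  have hr : Tendsto r U (𝓝 r₀) := (hlim R hRc).congr' (by
    filter_upwards [hev] with q hq using hRr q hq)
  have hMv : (p.2.2.1 - p.2.2.2).mulVec v₀ = r₀ • v₀ := by
    have h1 := hlim (fun x => (M x.1).mulVec x.2.1) (by simp only [M]; fun_prop)
    refine tendsto_nhds_unique (h1.congr' ?_) (hr.smul hv)
    filter_upwards [hev] with q hq using (hrvw q hq).2.2.2.1
  have hMw : (p.2.2.1 - p.2.2.2).transpose.mulVec w₀ = r₀ • w₀ := by
    have h1 := hlim (fun x => (M x.1).transpose.mulVec x.2.2) (by simp only [M]; fun_prop)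
    refine tendsto_nhds_unique (h1.congr' ?_) (hr.smul hw)
    filter_upwards [hev] with q hq using (hrvw q hq).2.2.2.2.1
  have hquad : quadCoeff a₁ a₂ (p.1 • 1 + p.2.2.1) (p.2.1 • 1 + p.2.2.2) v₀ w₀ = 0 := by
    have h1 := hlim (fun x => quadCoeff a₁ a₂ (x.1.1 • 1 + x.1.2.2.1)
      (x.1.2.1 • 1 + x.1.2.2.2) x.2.1 x.2.2) (by
        simp only [quadCoeff]
        fun_prop)
    refine tendsto_nhds_unique (h1.congr' ?_) tendsto_const_nhds
    filter_upwards [hev] with q hq using (hrvw q hq).2.2.2.2.2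
  have hv₀ne : v₀ ≠ 0 := by
    rintro rfl
    have : (0 : Fin Na → ℝ) ⬝ᵥ 0 = 1 := hv₀
    simp at this
  have hle : r₀ ≤ lam := hadm.leading.le_of_isRoot (isRoot_of_mulVec_eq_smul hv₀ne hMv)
  -- Near `p` there is a real eigenvalue at least `lam - ε`, and the leading eigenvalue dominates
  -- it.
  have hge : lam ≤ r₀ := by
    refine le_of_forall_pos_le_add fun ε hε => ?_
    have h1 := ((hcM.tendsto p).mono_left hUp).eventually (hsimple.eventually_exists_isRoot hε)
    have h2 : lam - ε ≤ r₀ := by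
      refine ge_of_tendsto hr ?_
      filter_upwards [h1, hev] with q ⟨z, hz1, hz2⟩ hq
      exact hz1.trans ((hrvw q hq).1.leading.le_of_isRoot hz2)
    linarith
  have heq : r₀ = lam := le_antisymm hle hge
  rw [heq] at hMv hMw
  exact ⟨lam, v₀, w₀, hadm, hv₀, hw₀, hMv, hMw, hquad⟩

/-- Since `E v` is concentrated on agent `i`, only the `i`-th summand changes, and it is quadratic
in `t`. -/
theorem quadCoeff_add_smul (A B E : Matrix (Fin Na) (Fin Na) ℝ) (v w : Fin Na → ℝ) {i : Fin Na}
    {c : ℝ} (hE : E.mulVec v = Pi.single i c) (t : ℝ) :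
    quadCoeff a₁ a₂ (A + t • E) (B + t • E) v w = quadCoeff a₁ a₂ A B v w +
      t * (2 * (w i * c) * (a₁ * A.mulVec v i - a₂ * B.mulVec v i)) +
      t ^ 2 * (w i * c ^ 2 * (a₁ - a₂)) := by
  have h1 : ∀ m, w m * (a₁ * (A + t • E).mulVec v m ^ 2 - a₂ * (B + t • E).mulVec v m ^ 2) =
      w m * (a₁ * A.mulVec v m ^ 2 - a₂ * B.mulVec v m ^ 2) +
      if m = i then t * (2 * (w i * c) * (a₁ * A.mulVec v i - a₂ * B.mulVec v i)) +
        t ^ 2 * (w i * c ^ 2 * (a₁ - a₂)) else 0 := by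
    intro m
    rw [Matrix.add_mulVec, Matrix.add_mulVec, Matrix.smul_mulVec, hE]
    simp only [Pi.add_apply, Pi.smul_apply, smul_eq_mul, Pi.single_apply]
    split_ifs with hm
    · subst hm
      ring
    · ring
  simp only [quadCoeff, h1, Finset.sum_add_distrib, Finset.sum_ite_eq', Finset.mem_univ, if_true]
  ring

theorem eventually_quadratic_ne_zero {q₀ q₁ q₂ : ℝ} (h : q₁ ≠ 0 ∨ q₂ ≠ 0) :
    ∀ᶠ t in 𝓝[≠] (0 : ℝ), q₀ + t * q₁ + t ^ 2 * q₂ ≠ 0 := by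
  set P : Polynomial ℝ := Polynomial.C q₀ + Polynomial.C q₁ * Polynomial.X +
    Polynomial.C q₂ * Polynomial.X ^ 2 with hP
  have hP0 : P ≠ 0 := by
    intro h0
    rcases h with h | h
    · apply h
      have := congrArg (fun Q => Polynomial.coeff Q 1) h0
      simpa [hP, Polynomial.coeff_X, Polynomial.coeff_C, Polynomial.coeff_X_pow] using this
    · apply h
      have := congrArg (fun Q => Polynomial.coeff Q 2) h0
      simpa [hP, Polynomial.coeff_X, Polynomial.coeff_C, Polynomial.coeff_X_pow] using this
  have hfin : {t | P.IsRoot t}.Finite := Polynomial.finite_setOfPred_isRoot hP0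
  filter_upwards [nhdsNE_le_cofinite 0 hfin.eventually_cofinite_notMem] with t ht h0
  apply ht
  change P.eval t = 0
  simp only [hP, Polynomial.eval_add, Polynomial.eval_mul,
    Polynomial.eval_C, Polynomial.eval_X, Polynomial.eval_pow]
  linarith

/-- A direction in parameter space that preserves `Γ - Δ` and `α - β` and moves one component. -/
theorem exists_shift {v : Fin Na → ℝ} {i : Fin Na} (hi : v i ≠ 0) :
    ∃ (a c : ℝ) (E : Matrix (Fin Na) (Fin Na) ℝ), c ≠ 0 ∧ (∀ m, E m m = 0) ∧
      (a • 1 + E).mulVec v = Pi.single i c := by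
  by_cases h : ∃ k, k ≠ i ∧ v k ≠ 0
  · obtain ⟨k, hki, hk⟩ := h
    refine ⟨0, v k, Matrix.single i k 1, hk, fun m => ?_, ?_⟩
    · rw [Matrix.single_apply, if_neg]
      rintro ⟨rfl, h2⟩
      exact hki h2
    · rw [zero_smul, zero_add, Matrix.single_mulVec]
      funext m
      simp [Function.update_apply, Pi.single_apply]
  · push Not at h
    -- If `v` lives on agent `i` alone, off-diagonal entries of row `i` have no effect on `v`, so
    -- the shift has to act on `α` and `β`.
    refine ⟨1, v i, 0, hi, fun m => rfl, ?_⟩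
    rw [one_smul, add_zero, Matrix.one_mulVec]
    funext m
    rcases eq_or_ne m i with rfl | hm
    · simp
    · rw [Pi.single_eq_of_ne hm, h m hm]

theorem exists_unit_smul {n : ℕ} {v : Fin n → ℝ} (hv : v ≠ 0) :
    ∃ c : ℝ, c ≠ 0 ∧ (c • v) ⬝ᵥ (c • v) = 1 := by
  have h := dotProduct_self_pos hv
  have hs := Real.sqrt_pos.2 h
  refine ⟨(Real.sqrt (v ⬝ᵥ v))⁻¹, inv_ne_zero hs.ne', ?_⟩
  rw [smul_dotProduct, dotProduct_smul, smul_eq_mul, smul_eq_mul, ← mul_assoc, ← mul_inv,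
    Real.mul_self_sqrt h.le, inv_mul_cancel₀ h.ne']

/-- Adding the same `t (a + E)` to `A` and `B` keeps `Γ - Δ` and `α - β`, hence the leading
eigenvalue, its eigenvectors and admissibility. Along this line the quadratic coefficient is a
nonconstant polynomial in `t`, so it is nonzero for arbitrarily small `t`. -/
theorem simpleParams_subset_closure (ha₁ : a₁ ≠ 0) :
    simpleParams Na ⊆ closure ((closure (degenerateParams Na a₁ a₂))ᶜ ∩ simpleParams Na) := by
  rintro ⟨α, β, Γ, Δ⟩ ⟨lam, hadm, hs⟩
  simp only at hadm hs
  obtain ⟨v, hv, hMv⟩ := exists_mulVec_eq_smul hadm.isRoot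
  obtain ⟨w, hw, hMw⟩ := exists_mulVec_eq_smul hs.transpose.isRoot
  have hwv := hs.dotProduct_ne_zero hv hMv hw hMw
  -- Nonorthogonality of the left and right eigenvectors provides an agent on which both are
  -- nonzero.
  obtain ⟨i, hi⟩ : ∃ i, w i * v i ≠ 0 := by
    by_contra! hall
    exact hwv (Finset.sum_eq_zero fun i _ => hall i)
  have hwi : w i ≠ 0 := left_ne_zero_of_mul hi
  have hvi : v i ≠ 0 := right_ne_zero_of_mul hi
  obtain ⟨a, c, E, hc, hE, hEv⟩ := exists_shift hvi
  let γ : ℝ → Params Na := fun t => (α + t * a, β + t * a, Γ + t • E, Δ + t • E)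
  have hγc : Continuous γ := by
    simp only [γ]
    fun_prop
  have hγ0 : γ 0 = (α, β, Γ, Δ) := by simp [γ]
  have hdiff : ∀ t : ℝ, Γ + t • E - (Δ + t • E) = Γ - Δ := fun t => add_sub_add_right_eq_sub _ _ _
  have hAdm : ∀ t, IsAdmissible (α + t * a) (β + t * a) (Γ + t • E) (Δ + t • E) lam := by
    intro t
    refine ⟨fun m => ?_, fun m => ?_, ?_, ?_⟩
    · simp [hadm.diag_left m, hE m]
    · simp [hadm.diag_right m, hE m]
    · rw [hdiff]
      exact hadm.leading
    · linarith [hadm.pos]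
  have hmem : ∀ t, γ t ∈ simpleParams Na := fun t =>
    ⟨lam, hAdm t, by
      simp only [γ]
      rw [hdiff]
      exact hs⟩
  have hcoeff : ∀ (t x : ℝ) (A : Matrix (Fin Na) (Fin Na) ℝ),
      (x + t * a) • 1 + (A + t • E) = (x • 1 + A) + t • (a • 1 + E) := by
    intro t x A
    module
  set A : Matrix (Fin Na) (Fin Na) ℝ := α • 1 + Γ with hA
  set B : Matrix (Fin Na) (Fin Na) ℝ := β • 1 + Δ with hB
  have hAB : A.mulVec v i = B.mulVec v i + (α - β + lam) * v i := by
    have e : A = B + ((α - β) • 1 + (Γ - Δ)) := by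
      rw [hA, hB]
      module
    rw [e, Matrix.add_mulVec B, Matrix.add_mulVec ((α - β) • 1), Matrix.smul_mulVec,
      Matrix.one_mulVec, hMv]
    simp only [Pi.add_apply, Pi.smul_apply, smul_eq_mul]
    ring
  have hnondeg : ∀ᶠ t in 𝓝[≠] (0 : ℝ),
      quadCoeff a₁ a₂ (A + t • (a • 1 + E)) (B + t • (a • 1 + E)) v w ≠ 0 := by
    simp only [quadCoeff_add_smul A B (a • 1 + E) v w hEv]
    refine eventually_quadratic_ne_zero ?_
    -- If `a₁ = a₂` the `t²` term vanishes, and the linear one is a nonzero multiple of `a₁ (α - β +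
    -- λ) v_i`; otherwise the `t²` term survives.
    rcases eq_or_ne a₁ a₂ with rfl | hne
    · refine Or.inl (mul_ne_zero (mul_ne_zero two_ne_zero (mul_ne_zero hwi hc)) ?_)
      rw [hAB, ← mul_sub, add_sub_cancel_left]
      exact mul_ne_zero ha₁ (mul_ne_zero hadm.pos.ne' hvi)
    · exact Or.inr (mul_ne_zero (mul_ne_zero hwi (pow_ne_zero 2 hc)) (sub_ne_zero.2 hne))
  have hlim : Tendsto γ (𝓝[≠] 0) (𝓝 (α, β, Γ, Δ)) := by
    rw [← hγ0]
    exact (hγc.tendsto 0).mono_left nhdsWithin_le_nhds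
  refine mem_closure_of_tendsto hlim ?_
  filter_upwards [hnondeg] with t ht
  refine ⟨fun hcl => ?_, hmem t⟩
  obtain ⟨lam', v', w', h1, h2, h3, h4, h5, h6⟩ :=
    mem_degenerateParams_of_mem_closure (hmem t) hcl
  simp only [γ] at h1 h4 h5 h6
  rw [hcoeff, hcoeff] at h6
  have hl : lam = lam' := (hAdm t).leading.unique h1.leading
  subst hl
  rw [hdiff] at h4 h5
  obtain ⟨c₁, rfl⟩ := hs.exists_eq_smul hv hMv h4
  obtain ⟨c₂, rfl⟩ := hs.transpose.exists_eq_smul hw hMw h5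
  rw [quadCoeff_smul] at h6
  have hc₁ : c₁ ≠ 0 := by
    rintro rfl
    simp at h2
  have hc₂ : c₂ ≠ 0 := by
    rintro rfl
    simp at h3
  exact mul_ne_zero (mul_ne_zero hc₂ (pow_ne_zero 2 hc₁)) ht h6

theorem quadCoeff_ne_zero_of_notMem {α β lam : ℝ} {Γ Δ : Matrix (Fin Na) (Fin Na) ℝ}
    (h : IsAdmissible α β Γ Δ lam) (hnot : (α, β, Γ, Δ) ∉ degenerateParams Na a₁ a₂)
    {v l : Fin Na → ℝ} (hvv : v ⬝ᵥ v = 1) (hMv : (Γ - Δ).mulVec v = lam • v) (hl : l ≠ 0)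
    (hMl : (Γ - Δ).transpose.mulVec l = lam • l) :
    quadCoeff a₁ a₂ (α • 1 + Γ) (β • 1 + Δ) v l ≠ 0 := by
  intro h0
  obtain ⟨c, -, hc⟩ := exists_unit_smul hl
  refine hnot ⟨lam, v, c • l, h, hvv, hc, hMv, ?_, ?_⟩
  · rw [Matrix.mulVec_smul, hMl, smul_comm]
  · have := quadCoeff_smul a₁ a₂ (α • 1 + Γ) (β • 1 + Δ) v l 1 c
    rwa [one_smul, h0, mul_zero] at this

end Generic

/-! ### The main theorem -/

theorem theorem2 {Na No : ℕ} (hNo : 2 ≤ No) (S₁ S₂ : ℝ → ℝ)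
    (hS₁ : IsSaturating S₁) (hS₂ : IsSaturating S₂) (d : ℝ) (hd : 0 < d) :
    -- for all parameters
    (∀ (α β : ℝ) (Γ Δ : Matrix (Fin Na) (Fin Na) ℝ) (lam : ℝ), IsAdmissible α β Γ Δ lam →
      -- stability below and instability above the threshold
      (∀ u, 0 < u → u < d / (α - β + lam) →
        IsLocallyExpStable (homField No S₁ S₂ d α β Γ Δ u)) ∧
      (∀ u, d / (α - β + lam) < u →
        ¬ IsLyapunovStable (homField No S₁ S₂ d α β Γ Δ u)) ∧
      -- steady-state bifurcation along the kernel
      (IsSimpleEigenvalue (Γ - Δ) lam →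
        ∀ v : Fin Na → ℝ, v ⬝ᵥ v = 1 → (Γ - Δ).mulVec v = lam • v →
          LinearMap.ker
              (fderiv ℝ (homField No S₁ S₂ d α β Γ Δ (d / (α - β + lam))) 0).toLinearMap =
            LinearMap.range (tensorState No v) ∧
          (∃ (u : ℝ → ℝ) (Z : ℝ → StateSpace Na No),
            IsBifurcationBranch (homField No S₁ S₂ d α β Γ Δ) (d / (α - β + lam)) u Z) ∧
          (∀ (u : ℝ → ℝ) (Z : ℝ → StateSpace Na No),
            IsBifurcationBranch (homField No S₁ S₂ d α β Γ Δ) (d / (α - β + lam)) u Z →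
            IsTangentTo Z (LinearMap.range (tensorState No v))) ∧
          (∀ x : optionSpace No, IsAxialVector x →
            ∃ (u : ℝ → ℝ) (Z : ℝ → StateSpace Na No),
              IsBifurcationBranch (homField No S₁ S₂ d α β Γ Δ) (d / (α - β + lam)) u Z ∧
              HasDerivWithinAt Z (tensorState No v x) (Ici 0) 0))) ∧
    -- for generic parameters, every branch is tangent to an axial direction
    (∃ G : Set (ℝ × ℝ × Matrix (Fin Na) (Fin Na) ℝ × Matrix (Fin Na) (Fin Na) ℝ),
      IsOpen G ∧ simpleParams Na ⊆ closure (G ∩ simpleParams Na) ∧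
      ∀ (α β : ℝ) (Γ Δ : Matrix (Fin Na) (Fin Na) ℝ) (lam : ℝ), (α, β, Γ, Δ) ∈ G →
        IsAdmissible α β Γ Δ lam → IsSimpleEigenvalue (Γ - Δ) lam →
        ∀ v : Fin Na → ℝ, v ⬝ᵥ v = 1 → (Γ - Δ).mulVec v = lam • v →
          ∀ (u : ℝ → ℝ) (Z : ℝ → StateSpace Na No),
            IsBifurcationBranch (homField No S₁ S₂ d α β Γ Δ) (d / (α - β + lam)) u Z →
            ∃ x : optionSpace No, IsAxialVector x ∧
              IsTangentTo Z (Submodule.span ℝ {tensorState No v x})) := by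
  have ha₁ : iteratedDeriv 2 S₁ 0 / 2 ≠ 0 := div_ne_zero hS₁.deriv_two_ne two_ne_zero
  refine ⟨fun α β Γ Δ lam h => ⟨fun u hu hu' => neutral_isLocallyExpStable hS₁ hS₂ h hu hu',
      fun u hu => neutral_not_isLyapunovStable hNo hS₁ hS₂ hd h hu, fun hs v hvv hMv =>
        ⟨ker_fderiv_homField hS₁ hS₂ hd h hs hvv hMv, ?_,
          fun u Z hb => branch_isTangentTo_range hS₁ hS₂ hd h hs hvv hMv hb,
          fun x hx => exists_axial_branch hS₁ hS₂ hd h hs hvv hMv hx⟩⟩,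
    -- Taking the complement of the closure gives an open set at once; relative closedness of
    -- degeneracy at simple parameters is what keeps it dense.
    (closure (degenerateParams Na (iteratedDeriv 2 S₁ 0 / 2) (iteratedDeriv 2 S₂ 0 / 2)))ᶜ,
    isClosed_closure.isOpen_compl, simpleParams_subset_closure ha₁,
    fun α β Γ Δ lam hG h hs v hvv hMv u Z hb => ?_⟩
  · obtain ⟨u, Z, hb, -⟩ := exists_axial_branch hS₁ hS₂ hd h hs hvv hMv
      (peakVector_isAxialVector hNo ⟨0, by omega⟩)
    exact ⟨u, Z, hb⟩
  · obtain ⟨l, hl, hMl⟩ := hs.exists_left_eigenvector hvv hMv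
    have hl0 : l ≠ 0 := by
      rintro rfl
      simp at hl
    exact branch_isTangentTo_axial hS₁ hS₂ hd h hs hvv hMv hl hMl
      (quadCoeff_ne_zero_of_notMem h (fun hmem => hG (subset_closure hmem)) hvv hMv hl0 hMl) hb
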